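/- Let $n\ge 1$ and let $a_1<a_2<\dots<a_n$ be natural numbers that are multiplicatively independent, i.e. the products $a_1^{q_1}\cdots a_n^{q_n}$ with $(q_1,\dots,q_n)\in\mathbb{N}_0^n$ are pairwise distinct (in particular all $a_k\ge 2$; this holds for instance if all $a_k\ge2$ and the $a_k$ are pairwise coprime). For real $x\ge 1$ put $$N(x)=\#\{(q_1,\dots,q_n)\in\mathbb{N}_0^n : a_1^{q_1}\cdots a_n^{q_n}\le x\},\qquad S=\{a_1^{q_1}\cdots a_n^{q_n}: q_1,\dots,q_n\in\mathbb{N}_0\},$$ let $\chi_S$ be the characteristic function of $S$, and let $B_1^*(\{y\})=\{y\}-\tfrac12$ if $y\notin\mathbb{Z}$ and $B_1^*(\{y\})=0$ if $y\in\mathbb{Z}$, where $\{y\}$ is the fractional part of $y$. For real $R>0$ put $$\Sigma_R(x)=\sum_{m=1}^{n}\ \sum_{r=1}^{n-1}\ \sum_{\substack{I\subset\{1,\dots,n\}\setminus\{m\}\\ |I|=r}}\ \sum_{k=1}^{\lfloor R\log a_m\rfloor}\frac{\sin\left(2\pi k\frac{\log x}{\log a_m}-\frac{\pi r}{2}\right)}{k}\prod_{l\in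 I}\cot\left(\frac{\pi k\log a_l}{\log a_m}\right).$$ For $\delta>0$ let $\mathcal{R}_\delta$ be the set of real $R$ such that $|R\log a_m-k|\ge\delta$ for all $1\le m\le n$ and all $k\in\mathbb{Z}$. Then $\mathcal{R}_\delta$ is unbounded above for every $\delta<\frac1{2n}$, and for every real $x\ge1$ and every $\delta>0$ $$N(x)=\operatorname*{Res}_{s=0}\left(\frac{x^s}{s\prod_{k=1}^n\left(1-a_k^{-s}\right)}\right)-\frac{1}{2^{n-1}}\sum_{k=1}^n B_1^*\left(\left\{\frac{\log x}{\log a_k}\right\}\right)+\frac{1}{2^{n-1}\pi}\lim_{\substack{R\to\infty\\ R\in\mathcal{R}_\delta}}\Sigma_R(x)+\frac12\chi_S(x).$$ -/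

import Mathlib

open Filter Topology

noncomputable section

namespace SmoothCount

/-- The residue of `f` at an isolated singularity `z₀`: the (eventually constant) value of
`(2πi)⁻¹ ∮ f` over circles around `z₀` of small radius. -/
def residue (f : ℂ → ℂ) (z₀ : ℂ) : ℂ :=
  limUnder (𝓝[>] (0 : ℝ))
    (fun ρ : ℝ => (2 * (Real.pi : ℂ) * Complex.I)⁻¹ * ∮ z in C(z₀, ρ), f z)

/-- `B₁*({y})`: equal to `{y} - 1/2` for non-integral `y` and to `0` for integral `y`. -/
def B1star (y : ℝ) : ℝ :=
  if Int.fract y = 0 then 0 else Int.fract y - 1 / 2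

variable {n : ℕ}

/-- The product `a₁^{q₁} ⋯ aₙ^{qₙ}`. -/
def powProd (a : Fin n → ℕ) (q : Fin n → ℕ) : ℕ :=
  ∏ i, a i ^ q i

/-- The number of exponent tuples `q` with `a₁^{q₁} ⋯ aₙ^{qₙ} ≤ x`. -/
def count (a : Fin n → ℕ) (x : ℝ) : ℕ :=
  {q : Fin n → ℕ | (powProd a q : ℝ) ≤ x}.ncard

/-- The set of all products `a₁^{q₁} ⋯ aₙ^{qₙ}`, as real numbers. -/
def productSet (a : Fin n → ℕ) : Set ℝ :=
  Set.range (fun q : Fin n → ℕ => (powProd a q : ℝ))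

/-- The characteristic function of `productSet a`. -/
def chi (a : Fin n → ℕ) : ℝ → ℝ :=
  (productSet a).indicator 1

/-- The function `s ↦ x^s / (s ∏ₖ (1 - 1 / aₖ^s))`. -/
def kernel (a : Fin n → ℕ) (x : ℝ) (s : ℂ) : ℂ :=
  (x : ℂ) ^ s / (s * ∏ k, (1 - 1 / (a k : ℂ) ^ s))

/-- The partial sum up to `⌊R log aₘ⌋` of the series attached to the index `m` and to the set
`{aᵢ : i ∈ I}` of `r = |I|` further bases. -/
def partialSeries (a : Fin n → ℕ) (x : ℝ) (m : Fin n) (I : Finset (Fin n)) (R : ℝ) : ℝ :=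
  ∑ k ∈ Finset.Icc 1 ⌊R * Real.log (a m)⌋₊,
    Real.sin (2 * Real.pi * k * (Real.log x / Real.log (a m)) - Real.pi * (I.card : ℝ) / 2) / k *
      ∏ l ∈ I, Real.cot (Real.pi * k * Real.log (a l) / Real.log (a m))

/-- The sum of the truncated series over all `m`, all `1 ≤ r ≤ n - 1` and all `r`-element sets of
bases other than `aₘ`, with one common truncation parameter `R`. -/
def truncatedSum (a : Fin n → ℕ) (x R : ℝ) : ℝ :=
  ∑ m, ∑ r ∈ Finset.Icc 1 (n - 1), ∑ I ∈ (Finset.univ.erase m).powersetCard r,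
    partialSeries a x m I R

/-- The truncation parameters `R` for which every `R log aₘ` has distance at least `δ` from the
integers, that is, `R` keeps away from the points `k / log aₘ` at which a term is added. -/
def admissible (a : Fin n → ℕ) (δ : ℝ) : Set ℝ :=
  {R | ∀ m, ∀ k : ℤ, δ ≤ |R * Real.log (a m) - k|}

end SmoothCount

end

/-!
Write `L m = log (a m)` and `u = log x`, so that the kernel becomes
`exp (u s) / (s ∏ₘ (1 - exp (-(L m s))))`, and integrate it over the circle `|s| = 2πR`. If `R` is
admissible, the factors `1 - exp (-(L m s))` are bounded away from zero on the circle. On the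
right half, expanding them into geometric series turns the integral into a sum of Perron
integrals, each of which tends to a unit step; this yields the number of `q` with
`∑ q m L m ≤ u`, those with equality counted with weight `1 / 2`. On the left half the product
grows like `exp (-(∑ L m) (re s))` and the integral tends to zero.

By the residue theorem the same integral is the residue at `0` plus those at the points
`2πik / L m`, which are simple poles because, by multiplicative independence, the ratios
`L m / L l` are irrational. There `(1 - exp (-2iθ))⁻¹ = (1 - i cot θ) / 2`, so multiplying out
the remaining factors and pairing `k` with `-k` gives one trigonometric series for every set of
indices other than `m`. The series of the empty set is the Fourier series of the sawtooth function
and sums to a multiple of `B₁*`.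
-/

namespace SmoothCount

open Metric Polynomial
open Complex (I exp)
open scoped Real ComplexConjugate

/-! ### Residues -/

theorem circleIntegrable_eval_inv_sub (Q : ℂ[X]) {c p : ℂ} {R : ℝ} (hp : p ∈ ball c R) :
    CircleIntegrable (fun s => Q.eval (s - p)⁻¹) c R := by
  refine ContinuousOn.circleIntegrable (pos_of_mem_ball hp).le fun s hs => ?_
  have hsp : s - p ≠ 0 := sub_ne_zero.2 (ne_of_mem_of_not_mem hs fun h => (mem_ball.1 hp).ne h)
  exact (Q.continuous.continuousAt.comp (by fun_prop (disch := assumption))).continuousWithinAt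

theorem circleIntegral_eval_inv_sub (Q : ℂ[X]) {c p : ℂ} {R : ℝ} (hp : p ∈ ball c R) :
    (∮ s in C(c, R), Q.eval (s - p)⁻¹) = 2 * π * I * Q.coeff 1 := by
  induction Q using Polynomial.induction_on' with
  | add P Q hP hQ =>
    simp only [eval_add, coeff_add, mul_add]
    rw [circleIntegral.integral_add (circleIntegrable_eval_inv_sub P hp)
      (circleIntegrable_eval_inv_sub Q hp), hP, hQ]
  | monomial n a =>
    simp only [eval_monomial, coeff_monomial, circleIntegral.integral_const_mul]
    split_ifs with hn
    · simp only [hn, pow_one, circleIntegral.integral_sub_inv_of_mem_ball hp, mul_comm]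
    · have h := circleIntegral.integral_sub_zpow_of_ne (n := -(n : ℤ)) (by omega) c p R
      simp only [zpow_neg, zpow_natCast, ← inv_pow] at h
      rw [h, mul_zero, mul_zero]

theorem circleIntegral_eq_zero_of_analyticOnNhd {f : ℂ → ℂ} {c : ℂ} {R : ℝ} (hR : 0 ≤ R)
    (hf : AnalyticOnNhd ℂ f (closedBall c R)) : (∮ z in C(c, R), f z) = 0 :=
  Complex.circleIntegral_eq_zero_of_differentiable_on_off_countable hR Set.countable_empty
    hf.continuousOn fun s hs => (hf s (ball_subset_closedBall hs.1)).differentiableAt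

theorem residue_congr {f g : ℂ → ℂ} {p : ℂ} (h : f =ᶠ[𝓝[≠] p] g) : residue f p = residue g p := by
  obtain ⟨r, hr, hball⟩ := Metric.eventually_nhds_iff_ball.1 (eventually_nhdsWithin_iff.1 h)
  unfold residue limUnder
  refine congrArg lim (Filter.map_congr ?_)
  filter_upwards [Ioo_mem_nhdsGT hr] with ρ hρ
  refine congrArg _ (circleIntegral.integral_congr hρ.1.le fun s hs => ?_)
  exact hball s (closedBall_subset_ball hρ.2 (sphere_subset_closedBall hs))
    (ne_of_mem_sphere hs hρ.1.ne')

theorem residue_eval_inv_sub_add (Q : ℂ[X]) {h : ℂ → ℂ} {p : ℂ} (hh : AnalyticAt ℂ h p) :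
    residue (fun s => Q.eval (s - p)⁻¹ + h s) p = Q.coeff 1 := by
  obtain ⟨r, hr, hball⟩ := Metric.eventually_nhds_iff_ball.1 hh.eventually_analyticAt
  refine Tendsto.limUnder_eq (tendsto_const_nhds.congr' ?_)
  filter_upwards [Ioo_mem_nhdsGT hr] with ρ hρ
  have hsub : AnalyticOnNhd ℂ h (closedBall p ρ) := fun s hs =>
    hball s (closedBall_subset_ball hρ.2 hs)
  have hint : CircleIntegrable h p ρ :=
    (hsub.continuousOn.mono sphere_subset_closedBall).circleIntegrable hρ.1.le
  have hp : p ∈ ball p ρ := mem_ball_self hρ.1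
  rw [circleIntegral.integral_add (circleIntegrable_eval_inv_sub Q hp) hint,
    circleIntegral_eval_inv_sub Q hp, circleIntegral_eq_zero_of_analyticOnNhd hρ.1.le hsub,
    add_zero, inv_mul_cancel_left₀ Complex.two_pi_I_ne_zero]

theorem exists_principalPart {f : ℂ → ℂ} {p : ℂ} (hf : MeromorphicAt f p) :
    ∃ (Q : ℂ[X]) (h : ℂ → ℂ), AnalyticAt ℂ h p ∧
      f =ᶠ[𝓝[≠] p] fun s => Q.eval (s - p)⁻¹ + h s := by
  obtain ⟨n, hn⟩ := hf
  have hshift : AnalyticAt ℂ (fun z => z ^ n * f (p + z)) 0 := by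
    have := AnalyticAt.fun_comp_of_eq (g := fun z => (z - p) ^ n • f z) (f := fun z => p + z)
      (x := 0) hn (by fun_prop) (by simp)
    simpa only [add_sub_cancel_left, smul_eq_mul] using this
  obtain ⟨h, hh, htaylor⟩ := hshift.exists_eq_sum_add_pow_mul n
  simp only [smul_eq_mul] at htaylor
  refine ⟨∑ j ∈ Finset.range n, C (iteratedDeriv j (fun z => z ^ n * f (p + z)) 0 / j.factorial) *
      X ^ (n - j), fun s => h (s - p), ?_, ?_⟩
  · exact AnalyticAt.fun_comp_of_eq hh (by fun_prop) (sub_self p)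
  · filter_upwards [self_mem_nhdsWithin] with s hs
    have hsp : s - p ≠ 0 := sub_ne_zero.2 hs
    have h1 := htaylor (s - p)
    rw [add_sub_cancel] at h1
    refine mul_left_cancel₀ (pow_ne_zero n hsp) ?_
    rw [h1, mul_add, eval_finsetSum, Finset.mul_sum]
    refine congrArg₂ _ (Finset.sum_congr rfl fun j hj => ?_) rfl
    rw [← Nat.add_sub_cancel' (Finset.mem_range.1 hj).le, Nat.add_sub_cancel_left, pow_add]
    simp only [eval_mul, eval_C, eval_pow, eval_X, inv_pow]
    field_simp

theorem residue_sub_of_analyticAt {f g : ℂ → ℂ} {p : ℂ} (hf : MeromorphicAt f p)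
    (hg : AnalyticAt ℂ g p) : residue (fun s => f s - g s) p = residue f p := by
  obtain ⟨Q, h, hh, hfQ⟩ := exists_principalPart hf
  have hfg : (fun s => f s - g s) =ᶠ[𝓝[≠] p] fun s => Q.eval (s - p)⁻¹ + (h s - g s) := by
    filter_upwards [hfQ] with s hs
    rw [hs, add_sub_assoc]
  rw [residue_congr hfg, residue_congr hfQ, residue_eval_inv_sub_add Q (hh.fun_sub hg),
    residue_eval_inv_sub_add Q hh]

theorem analyticAt_eval_inv_sub (Q : ℂ[X]) {p z : ℂ} (hz : z ≠ p) :
    AnalyticAt ℂ (fun s => Q.eval (s - p)⁻¹) z := by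
  have hinv : AnalyticAt ℂ (fun s => (s - p)⁻¹) z :=
    AnalyticAt.fun_inv (by fun_prop) (sub_ne_zero.2 hz)
  simpa only [← Polynomial.coe_aeval_eq_eval] using hinv.aeval_polynomial Q

theorem exists_analyticAt_sub_principalPart {f : ℂ → ℂ} {p : ℂ} (hf : MeromorphicAt f p) :
    ∃ (Q : ℂ[X]) (g : ℂ → ℂ), AnalyticAt ℂ g p ∧ Q.coeff 1 = residue f p ∧
      ∀ z ≠ p, g =ᶠ[𝓝 z] fun s => f s - Q.eval (s - p)⁻¹ := by
  obtain ⟨Q, h, hh, hfQ⟩ := exists_principalPart hf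
  refine ⟨Q, Function.update (fun s => f s - Q.eval (s - p)⁻¹) p (h p), hh.congr ?_,
    by rw [residue_congr hfQ, residue_eval_inv_sub_add Q hh],
    fun z hz => (eventually_ne_nhds hz).mono fun s hs => by simp [hs]⟩
  filter_upwards [eventually_nhdsWithin_iff.1 hfQ] with s hs
  rcases eq_or_ne s p with rfl | hsp
  · simp
  · simp [hsp, hs hsp]

theorem circleIntegral_eq_sum_residue {f : ℂ → ℂ} {c : ℂ} {R : ℝ} (hR : 0 ≤ R) {P : Finset ℂ}
    (hP : ↑P ⊆ ball c R) (hmer : ∀ p ∈ P, MeromorphicAt f p)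
    (hf : ∀ z ∈ closedBall c R, z ∉ P → AnalyticAt ℂ f z) :
    (∮ z in C(c, R), f z) = 2 * π * I * ∑ p ∈ P, residue f p := by
  induction P using Finset.induction_on generalizing f with
  | empty =>
    rw [circleIntegral_eq_zero_of_analyticOnNhd hR fun z hz => hf z hz (Finset.notMem_empty z),
      Finset.sum_empty, mul_zero]
  | insert p P hpP ih =>
    rw [Finset.coe_insert, Set.insert_subset_iff] at hP
    obtain ⟨Q, g, hgp, hQ, hg_eq⟩ :=
      exists_analyticAt_sub_principalPart (hmer p (Finset.mem_insert_self p P))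
    have hg_mer : ∀ q ∈ P, MeromorphicAt g q := fun q hq =>
      have hqp : q ≠ p := ne_of_mem_of_not_mem hq hpP
      ((hmer q (Finset.mem_insert_of_mem hq)).fun_sub
        (analyticAt_eval_inv_sub Q hqp).meromorphicAt).congr
          ((hg_eq q hqp).symm.filter_mono nhdsWithin_le_nhds)
    have hg_an : ∀ z ∈ closedBall c R, z ∉ P → AnalyticAt ℂ g z := by
      intro z hz hzP
      rcases eq_or_ne z p with rfl | hzp
      · exact hgp
      · exact ((hf z hz (by simp [hzp, hzP])).fun_sub (analyticAt_eval_inv_sub Q hzp)).congr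
          (hg_eq z hzp).symm
    have hg_res : ∀ q ∈ P, residue g q = residue f q := fun q hq => by
      have hqp : q ≠ p := ne_of_mem_of_not_mem hq hpP
      rw [residue_congr ((hg_eq q hqp).filter_mono nhdsWithin_le_nhds), residue_sub_of_analyticAt
        (hmer q (Finset.mem_insert_of_mem hq)) (analyticAt_eval_inv_sub Q hqp)]
    have hg_int : CircleIntegrable g c R := ContinuousOn.circleIntegrable hR fun s hs =>
      (hg_an s (sphere_subset_closedBall hs)
        fun hsP => (mem_ball.1 (hP.2 hsP)).ne hs).continuousAt.continuousWithinAt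
    have hsplit : (∮ z in C(c, R), f z) = ∮ z in C(c, R), (Q.eval (z - p)⁻¹ + g z) :=
      circleIntegral.integral_congr hR fun s hs => by
        rw [(hg_eq s (ne_of_mem_of_not_mem hs (mem_ball.1 hP.1).ne)).eq_of_nhds, add_sub_cancel]
    rw [hsplit, circleIntegral.integral_add (circleIntegrable_eval_inv_sub Q hP.1) hg_int,
      circleIntegral_eval_inv_sub Q hP.1, hQ, ih hP.2 hg_mer hg_an, Finset.sum_insert hpP,
      Finset.sum_congr rfl hg_res, mul_add]

theorem residue_div {g h : ℂ → ℂ} {p : ℂ} (hg : AnalyticAt ℂ g p) (hh : AnalyticAt ℂ h p)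
    (hp : h p = 0) (hd : deriv h p ≠ 0) :
    residue (fun s => g s / h s) p = g p / deriv h p := by
  set w : ℂ → ℂ := fun s => g s / dslope h p s
  have hdslope : ∀ {f : ℂ → ℂ}, AnalyticAt ℂ f p → AnalyticAt ℂ (dslope f p) p :=
    fun ⟨q, hq⟩ => hq.has_fpower_series_dslope_fslope.analyticAt
  have hwp : AnalyticAt ℂ w p := hg.fun_div (hdslope hh) (by rwa [dslope_same])
  have hgh : (fun s => g s / h s) =ᶠ[𝓝[≠] p]
      fun s => (C (w p) * X : ℂ[X]).eval (s - p)⁻¹ + dslope w p s := by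
    filter_upwards [self_mem_nhdsWithin] with s hs
    have hsp : s - p ≠ 0 := sub_ne_zero.2 hs
    have h1 : h s = (s - p) * dslope h p s := by
      rw [← smul_eq_mul, sub_smul_dslope, hp, sub_zero]
    have h2 : (s - p) * dslope w p s = g s / dslope h p s - w p := sub_smul_dslope w p s
    rw [h1, mul_comm, ← div_div, eval_mul, eval_C, eval_X, ← div_eq_mul_inv,
      div_eq_iff hsp, add_mul, div_mul_cancel₀ _ hsp, mul_comm _ (s - p), h2, add_sub_cancel]
  rw [residue_congr hgh, residue_eval_inv_sub_add _ (hdslope hwp), coeff_C_mul, coeff_X_one,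
    mul_one]
  exact congrArg (g p / ·) (dslope_same h p)

/-! ### Integrals over half circles -/

/-- The closed right half of the circle of radius `T` around the origin. -/
def rightHalfCircle (T : ℝ) : Set ℂ :=
  {s | ‖s‖ = T ∧ 0 ≤ s.re}

/-- The contour integral of `f` along `rightHalfCircle T`, traversed upwards from `-T i` to
`T i`. -/
noncomputable def halfCircleIntegral (f : ℂ → ℂ) (T : ℝ) : ℂ :=
  ∫ θ in -(π / 2)..π / 2, deriv (circleMap 0 T) θ • f (circleMap 0 T θ)

theorem circleMap_zero_re (T θ : ℝ) : (circleMap 0 T θ).re = T * Real.cos θ := by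
  simp [circleMap, Complex.exp_ofReal_mul_I_re]

theorem circleMap_add_pi (T θ : ℝ) : circleMap 0 T (θ + π) = -circleMap 0 T θ := by
  simp [circleMap, add_mul, Complex.exp_add]

theorem circleMap_mem_rightHalfCircle {T θ : ℝ} (hT : 0 ≤ T)
    (hθ : θ ∈ Set.Icc (-(π / 2)) (π / 2)) : circleMap 0 T θ ∈ rightHalfCircle T :=
  ⟨by rw [norm_circleMap_zero, abs_of_nonneg hT], by
    rw [circleMap_zero_re]; exact mul_nonneg hT (Real.cos_nonneg_of_mem_Icc hθ)⟩

theorem intervalIntegrable_halfCircle {f : ℂ → ℂ} {T : ℝ} (hT : 0 ≤ T)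
    (hf : ContinuousOn f (rightHalfCircle T)) :
    IntervalIntegrable (fun θ => deriv (circleMap 0 T) θ • f (circleMap 0 T θ))
      MeasureTheory.volume (-(π / 2)) (π / 2) := by
  refine ContinuousOn.intervalIntegrable ?_
  rw [Set.uIcc_of_le (by linarith [Real.pi_pos])]
  simp only [deriv_circleMap]
  exact (by fun_prop : Continuous fun θ => circleMap 0 T θ * I).continuousOn.smul <|
    hf.comp (continuous_circleMap 0 T).continuousOn fun θ hθ => circleMap_mem_rightHalfCircle hT hθ

theorem halfCircleIntegral_sub {f g : ℂ → ℂ} {T : ℝ} (hT : 0 ≤ T)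
    (hf : ContinuousOn f (rightHalfCircle T)) (hg : ContinuousOn g (rightHalfCircle T)) :
    halfCircleIntegral (fun s => f s - g s) T
      = halfCircleIntegral f T - halfCircleIntegral g T := by
  simp only [halfCircleIntegral, smul_sub]
  exact intervalIntegral.integral_sub (intervalIntegrable_halfCircle hT hf)
    (intervalIntegrable_halfCircle hT hg)

theorem halfCircleIntegral_sum {κ : Type*} {S : Finset κ} {f : κ → ℂ → ℂ} {T : ℝ} (hT : 0 ≤ T)
    (hf : ∀ q ∈ S, ContinuousOn (f q) (rightHalfCircle T)) :
    halfCircleIntegral (fun s => ∑ q ∈ S, f q s) T = ∑ q ∈ S, halfCircleIntegral (f q) T := by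
  simp only [halfCircleIntegral, Finset.smul_sum]
  exact intervalIntegral.integral_finsetSum fun q hq => intervalIntegrable_halfCircle hT (hf q hq)

theorem circleIntegral_eq_halfCircleIntegral_sub {f : ℂ → ℂ} {T : ℝ} (hT : 0 ≤ T)
    (hf : ContinuousOn f (sphere 0 T)) :
    (∮ z in C(0, T), f z)
      = halfCircleIntegral f T - halfCircleIntegral (fun s => f (-s)) T := by
  set G : ℝ → ℂ := fun θ => deriv (circleMap 0 T) θ • f (circleMap 0 T θ) with hG
  have hper : Function.Periodic G (2 * π) := fun θ => by
    simp only [hG, deriv_circleMap, periodic_circleMap 0 T θ]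
  have hcont : Continuous G := by
    simp only [hG, deriv_circleMap]
    exact (by fun_prop : Continuous fun θ => circleMap 0 T θ * I).smul <|
      hf.comp_continuous (continuous_circleMap 0 T) (circleMap_mem_sphere 0 hT)
  have hshift : ∀ θ, G (θ + π) = -(deriv (circleMap 0 T) θ • f (-circleMap 0 T θ)) := fun θ => by
    simp only [hG, deriv_circleMap, circleMap_add_pi, neg_mul, neg_smul]
  calc (∮ z in C(0, T), f z)
      = ∫ θ in -(π / 2)..-(π / 2) + 2 * π, G θ := by
        rw [hper.intervalIntegral_add_eq (-(π / 2)) 0, zero_add]; rfl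
    _ = (∫ θ in -(π / 2)..π / 2, G θ) + ∫ θ in π / 2..-(π / 2) + 2 * π, G θ :=
        (intervalIntegral.integral_add_adjacent_intervals (hcont.intervalIntegrable _ _)
          (hcont.intervalIntegrable _ _)).symm
    _ = (∫ θ in -(π / 2)..π / 2, G θ) + ∫ θ in -(π / 2)..π / 2, G (θ + π) := by
        rw [intervalIntegral.integral_comp_add_right G π]; ring_nf
    _ = halfCircleIntegral f T - halfCircleIntegral (fun s => f (-s)) T := by
        simp only [hshift, intervalIntegral.integral_neg, ← sub_eq_add_neg]; rfl

section Limits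

variable {α : Type*} {F : Filter α} {T : α → ℝ}

theorem tendsto_integral_exp_neg_mul_cos [F.IsCountablyGenerated] (hT : Tendsto T F atTop) :
    Tendsto (fun i => ∫ θ in -(π / 2)..π / 2, Real.exp (-(T i * Real.cos θ))) F (𝓝 0) := by
  have hpi := Real.pi_pos
  have huIoc : Set.uIoc (-(π / 2)) (π / 2) = Set.Ioc (-(π / 2)) (π / 2) :=
    Set.uIoc_of_le (by linarith)
  have h := intervalIntegral.tendsto_integral_filter_of_dominated_convergence
    (μ := MeasureTheory.volume) (l := F)
    (F := fun i θ => Real.exp (-(T i * Real.cos θ))) (f := fun _ => 0) (a := -(π / 2)) (b := π / 2)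
    (fun _ => (1 : ℝ)) (Eventually.of_forall fun i => by fun_prop) ?_ (by simp) ?_
  · simpa using h
  · filter_upwards [hT.eventually_ge_atTop 0] with i hi
    refine Eventually.of_forall fun θ hθ => ?_
    rw [huIoc] at hθ
    rw [Real.norm_eq_abs, Real.abs_exp, Real.exp_le_one_iff, neg_nonpos]
    exact mul_nonneg hi (Real.cos_nonneg_of_mem_Icc ⟨hθ.1.le, hθ.2⟩)
  · filter_upwards [MeasureTheory.compl_mem_ae_iff.2 (MeasureTheory.measure_singleton (π / 2))]
      with θ hθ' hθ
    rw [huIoc] at hθ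
    have hcos : 0 < Real.cos θ := Real.cos_pos_of_mem_Ioo ⟨hθ.1, hθ.2.lt_of_ne hθ'⟩
    exact Real.tendsto_exp_neg_atTop_nhds_zero.comp (hT.atTop_mul_const hcos)

theorem tendsto_halfCircleIntegral_zero [F.IsCountablyGenerated] (hT : Tendsto T F atTop)
    {f : ℂ → ℂ} {c C : ℝ} (hc : 0 < c)
    (hf : ∀ᶠ i in F, ∀ s ∈ rightHalfCircle (T i), ‖s * f s‖ ≤ C * Real.exp (-(c * s.re))) :
    Tendsto (fun i => halfCircleIntegral f (T i)) F (𝓝 0) := by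
  have hbound : Tendsto
      (fun i => C * ∫ θ in -(π / 2)..π / 2, Real.exp (-(c * T i * Real.cos θ))) F (𝓝 0) := by
    simpa using (tendsto_integral_exp_neg_mul_cos (hT.const_mul_atTop hc)).const_mul C
  refine squeeze_zero_norm' ?_ hbound
  filter_upwards [hf, hT.eventually_ge_atTop 0] with i hi hTi
  rw [← intervalIntegral.integral_const_mul]
  refine intervalIntegral.norm_integral_le_of_norm_le (by linarith [Real.pi_pos])
    (Eventually.of_forall fun θ hθ => ?_) (Continuous.intervalIntegrable (by fun_prop) _ _)
  have h := hi _ (circleMap_mem_rightHalfCircle hTi ⟨hθ.1.le, hθ.2⟩)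
  rw [circleMap_zero_re, ← mul_assoc] at h
  rwa [deriv_circleMap, smul_eq_mul, mul_right_comm, norm_mul, Complex.norm_I, mul_one]

end Limits

/-! ### Perron's integral and lower bounds on admissible circles -/

/-- The unit step at the origin with the symmetric value `1 / 2` at the jump, as it arises from
Perron's integral. -/
noncomputable def heaviside (v : ℝ) : ℝ :=
  if v < 0 then 0 else if v = 0 then 1 / 2 else 1

theorem norm_mul_exp_div {v : ℝ} {s : ℂ} (hs : s ≠ 0) :
    ‖s * (exp (v * s) / s)‖ = Real.exp (v * s.re) := by
  rw [mul_div_cancel₀ _ hs, Complex.norm_exp, Complex.re_ofReal_mul]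

theorem ne_zero_of_mem_rightHalfCircle {T : ℝ} (hT : 0 < T) {s : ℂ}
    (hs : s ∈ rightHalfCircle T) : s ≠ 0 :=
  norm_pos_iff.1 (hs.1.symm ▸ hT)

theorem continuousOn_exp_div (v : ℝ) : ContinuousOn (fun s : ℂ => exp (v * s) / s) {0}ᶜ :=
  ContinuousOn.div (by fun_prop) continuousOn_id fun _ hs => hs

theorem halfCircleIntegral_one_div {T : ℝ} (hT : T ≠ 0) :
    halfCircleIntegral (fun s => 1 / s) T = π * I := by
  have h : ∀ θ, deriv (circleMap 0 T) θ • (1 / circleMap 0 T θ) = I := fun θ => by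
    have : circleMap 0 T θ ≠ 0 := circleMap_ne_center hT
    rw [deriv_circleMap, smul_eq_mul]
    field_simp
  simp only [halfCircleIntegral, h, intervalIntegral.integral_const, Complex.real_smul]
  push_cast
  ring

theorem circleIntegral_exp_div (v : ℝ) {T : ℝ} (hT : 0 < T) :
    (∮ s in C(0, T), exp (v * s) / s) = 2 * π * I := by
  have hexp : Differentiable ℂ fun s : ℂ => exp (v * s) := by fun_prop
  simpa [div_eq_inv_mul] using
    hexp.diffContOnCl.circleIntegral_sub_inv_smul (mem_ball_self hT (x := (0 : ℂ)))

theorem tendsto_halfCircleIntegral_exp_div (v : ℝ) :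
    Tendsto (halfCircleIntegral fun s => exp (v * s) / s) atTop (𝓝 (2 * π * I * heaviside v)) := by
  have hne : ∀ᶠ T : ℝ in atTop, ∀ s ∈ rightHalfCircle T, s ≠ 0 := by
    filter_upwards [eventually_gt_atTop 0] with T hT s hs
    exact ne_zero_of_mem_rightHalfCircle hT hs
  rcases lt_trichotomy v 0 with hv | rfl | hv
  · have h := tendsto_halfCircleIntegral_zero tendsto_id (f := fun s => exp (v * s) / s)
      (C := 1) (neg_pos.2 hv) (hne.mono fun T hT s hs => by
        rw [norm_mul_exp_div (hT s hs), neg_mul, neg_neg, one_mul])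
    simpa [heaviside, hv] using h
  · refine tendsto_const_nhds.congr' ?_
    filter_upwards [eventually_ne_atTop 0] with T hT
    simp only [Complex.ofReal_zero, zero_mul, Complex.exp_zero, halfCircleIntegral_one_div hT,
      heaviside, lt_irrefl, if_true, if_false]
    push_cast
    ring
  · have h : Tendsto (fun T => halfCircleIntegral (fun s => exp (v * -s) / -s) T) atTop (𝓝 0) := by
      refine tendsto_halfCircleIntegral_zero tendsto_id (C := 1) hv (hne.mono fun T hT s hs => ?_)
      have := norm_mul_exp_div (v := v) (neg_ne_zero.2 (hT s hs))
      rw [← norm_neg, ← neg_mul, this, Complex.neg_re, mul_neg, one_mul]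
    have h' := h.const_add (2 * π * I)
    rw [add_zero] at h'
    simp only [heaviside, hv.not_gt, hv.ne', if_false, Complex.ofReal_one, mul_one]
    refine h'.congr' ?_
    filter_upwards [eventually_gt_atTop 0] with T hT
    rw [← circleIntegral_exp_div v hT, circleIntegral_eq_halfCircleIntegral_sub hT.le
      ((continuousOn_exp_div v).mono fun s hs => ne_of_mem_sphere hs hT.ne'), sub_add_cancel]

theorem sum_heaviside_sub {κ : Type*} {w : κ → ℝ} {u : ℝ} {P : Finset κ}
    (hP : ∀ q, w q ≤ u → q ∈ P) :
    ∑ q ∈ P, heaviside (u - w q)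
      = ({q | w q ≤ u}.ncard : ℝ) - 1 / 2 * ({q | w q = u}.ncard : ℝ) := by
  have hle : {q | w q ≤ u} = ↑(P.filter fun q => w q ≤ u) := by
    ext q; simpa using hP q
  have heq : {q | w q = u} = ↑(P.filter fun q => w q = u) := by
    ext q; simpa using fun h => hP q (le_of_eq h)
  rw [hle, heq, Set.ncard_coe_finset, Set.ncard_coe_finset, Finset.card_filter, Finset.card_filter]
  push_cast
  rw [Finset.mul_sum, ← Finset.sum_sub_distrib]
  refine Finset.sum_congr rfl fun q _ => ?_
  rcases lt_trichotomy (w q) u with h | h | h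
  · simp [heaviside, h.ne, h.le, sub_eq_zero, h.ne']
  · simp [heaviside, h]; norm_num
  · simp [heaviside, h, h.not_ge, h.ne']

theorem two_mul_le_abs_sin {y δ : ℝ} (h : ∀ k : ℤ, δ ≤ |y - k|) : 2 * δ ≤ |Real.sin (π * y)| := by
  have hpi := Real.pi_pos
  have hround : |π * (y - round y)| ≤ π / 2 := by
    rw [abs_mul, abs_of_pos hpi]
    nlinarith [abs_sub_round y]
  have hsin : Real.sin (π * y) = (-1) ^ round y * Real.sin (π * (y - round y)) := by
    rw [← Real.sin_add_int_mul_pi]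
    ring_nf
  rw [hsin, abs_mul, abs_zpow, abs_neg, abs_one, one_zpow, one_mul]
  calc 2 * δ ≤ 2 * |y - round y| := by gcongr; exact h _
    _ = 2 / π * |π * (y - round y)| := by rw [abs_mul, abs_of_pos hpi]; field_simp
    _ ≤ |Real.sin (π * (y - round y))| := Real.mul_abs_le_abs_sin hround

theorem norm_one_sub_le_two_mul {w : ℂ} {r : ℝ} (hw : ‖w‖ = 1) (hr : 0 ≤ r) :
    ‖1 - w‖ ≤ 2 * ‖1 - r * w‖ := by
  have hradial : |r - 1| ≤ ‖1 - r * w‖ := by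
    simpa [hw, abs_of_nonneg hr, norm_sub_rev] using abs_norm_sub_norm_le (r * w) 1
  calc ‖1 - w‖ = ‖(1 - r * w) + (r - 1 : ℝ) * w‖ := by push_cast; ring_nf
    _ ≤ ‖1 - r * w‖ + ‖((r - 1 : ℝ) : ℂ) * w‖ := norm_add_le _ _
    _ = ‖1 - r * w‖ + |r - 1| := by rw [norm_mul, hw, mul_one, Complex.norm_real, Real.norm_eq_abs]
    _ ≤ 2 * ‖1 - r * w‖ := by linarith

theorem abs_sin_half_im_le_norm_one_sub_exp (z : ℂ) :
    |Real.sin (z.im / 2)| ≤ ‖1 - exp z‖ := by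
  have hz : exp z = Real.exp z.re * exp (I * z.im) := by
    rw [Complex.ofReal_exp, ← Complex.exp_add, mul_comm I, Complex.re_add_im]
  have h := norm_one_sub_le_two_mul (Complex.norm_exp_I_mul_ofReal z.im) (Real.exp_pos z.re).le
  rw [← hz, norm_sub_rev, Complex.norm_exp_I_mul_ofReal_sub_one, norm_mul, Real.norm_eq_abs,
    Real.norm_eq_abs, abs_two] at h
  linarith

theorem one_sub_exp_neg_le_norm_one_sub_exp {l : ℝ} (hl : 0 ≤ l) {s : ℂ} (hs : 1 ≤ s.re) :
    1 - Real.exp (-l) ≤ ‖1 - exp (-(l * s))‖ := by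
  have hexp : ‖exp (-(l * s))‖ ≤ Real.exp (-l) := by
    rw [Complex.norm_exp, Complex.neg_re, Complex.re_ofReal_mul, Real.exp_le_exp, neg_le_neg_iff]
    exact le_mul_of_one_le_right hl hs
  calc 1 - Real.exp (-l) ≤ ‖(1 : ℂ)‖ - ‖exp (-(l * s))‖ := by rw [norm_one]; gcongr
    _ ≤ ‖1 - exp (-(l * s))‖ := norm_sub_norm_le _ _

theorem sub_abs_im_le_inv {T : ℝ} (hT : 0 < T) {s : ℂ} (hs : s ∈ rightHalfCircle T)
    (hre : s.re ≤ 1) : T - |s.im| ≤ T⁻¹ := by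
  have hsq : s.re ^ 2 + |s.im| ^ 2 = T ^ 2 := by
    rw [sq_abs, ← hs.1, Complex.sq_norm, Complex.normSq_apply]; ring
  rw [← mul_le_mul_iff_right₀ hT, mul_inv_cancel₀ hT.ne']
  have him : |s.im| ≤ T := hs.1 ▸ Complex.abs_im_le_norm s
  nlinarith [hs.2, abs_nonneg s.im]

-- Where `re s ≤ 1`, `s` is so close to `±2πiR` that the bound on `|R l - k|` passes to
-- `|l (im s) / (2π) - k|`.
theorem min_le_norm_one_sub_exp {l δ R : ℝ} (hl : 0 < l) (hR : 0 < R) (hlR : l ≤ R * δ)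
    (h : ∀ k : ℤ, δ ≤ |R * l - k|) {s : ℂ} (hs : s ∈ rightHalfCircle (2 * π * R)) :
    min δ (1 - Real.exp (-l)) ≤ ‖1 - exp (-(l * s))‖ := by
  have hpi := Real.pi_gt_three
  rcases le_total 1 s.re with hre | hre
  · exact (min_le_right _ _).trans (one_sub_exp_neg_le_norm_one_sub_exp hl.le hre)
  have him : |s.im| ≤ 2 * π * R := hs.1 ▸ Complex.abs_im_le_norm s
  have hclose : |R * l - l * |s.im| / (2 * π)| ≤ δ / 2 := by
    have hinv := sub_abs_im_le_inv (by positivity) hs hre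
    have heq : R * l - l * |s.im| / (2 * π) = l / (2 * π) * (2 * π * R - |s.im|) := by
      field_simp
    rw [heq, abs_of_nonneg (mul_nonneg (by positivity) (sub_nonneg.2 him))]
    have hRδ : 0 ≤ R * δ := hl.le.trans hlR
    calc l / (2 * π) * (2 * π * R - |s.im|) ≤ R * δ / (2 * π) * (2 * π * R)⁻¹ := by gcongr
      _ = δ / (4 * π ^ 2) := by field_simp; norm_num
      _ ≤ δ / 2 := by
        have : 0 < δ := pos_of_mul_pos_right (hl.trans_le hlR) hR.le
        gcongr
        nlinarith
  have hfar : ∀ k : ℤ, δ / 2 ≤ |l * |s.im| / (2 * π) - k| := fun k => by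
    linarith [h k, abs_sub_le (R * l) (l * |s.im| / (2 * π)) k]
  calc min δ (1 - Real.exp (-l)) ≤ 2 * (δ / 2) := by rw [mul_div_cancel₀ _ two_ne_zero]; simp
    _ ≤ |Real.sin (π * (l * |s.im| / (2 * π)))| := two_mul_le_abs_sin hfar
    _ = |Real.sin ((-(l * s)).im / 2)| := by
      have : π * (l * |s.im| / (2 * π)) = l / 2 * |s.im| := by field_simp
      rw [this, Complex.neg_im, Complex.im_ofReal_mul, neg_div, Real.sin_neg, abs_neg]
      rcases abs_choice s.im with h | h
      · rw [h]; ring_nf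
      · rw [h, mul_neg, Real.sin_neg, abs_neg]; ring_nf
    _ ≤ ‖1 - exp (-(l * s))‖ := abs_sin_half_im_le_norm_one_sub_exp _

section Admissible

variable {ι : Type*} {L : ι → ℝ} {δ : ℝ}

/-- The parameters `R` for which the circle of radius `2πR` stays away from the zeros `2πik / L m`
of all the factors `1 - exp (-(L m s))`. -/
def admissibleFor (L : ι → ℝ) (δ : ℝ) : Set ℝ :=
  {R | ∀ m, ∀ k : ℤ, δ ≤ |R * L m - k|}

theorem eventually_mem_admissibleFor :
    ∀ᶠ R in atTop ⊓ 𝓟 (admissibleFor L δ), R ∈ admissibleFor L δ :=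
  mem_inf_of_right (mem_principal_self _)

variable [Fintype ι]

theorem exists_forall_le_norm_prod_one_sub_exp (hL : ∀ m, 0 < L m) (hδ : 0 < δ) :
    ∃ g > 0, ∀ᶠ R in atTop ⊓ 𝓟 (admissibleFor L δ), ∀ s ∈ rightHalfCircle (2 * π * R),
      g ≤ ‖∏ m, (1 - exp (-(L m * s)))‖ := by
  have hpos : ∀ m, 0 < min δ (1 - Real.exp (-L m)) := fun m =>
    lt_min hδ (by simpa using hL m)
  have hlarge : ∀ᶠ R : ℝ in atTop, ∀ m, L m ≤ R * δ :=
    eventually_all.2 fun m => (tendsto_id.atTop_mul_const hδ).eventually_ge_atTop (L m)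
  refine ⟨∏ m, min δ (1 - Real.exp (-L m)), Finset.prod_pos fun m _ => hpos m, ?_⟩
  filter_upwards [eventually_mem_admissibleFor, (eventually_gt_atTop 0).filter_mono inf_le_left,
    hlarge.filter_mono inf_le_left] with R hadm hR hLR s hs
  rw [norm_prod]
  exact Finset.prod_le_prod (fun m _ => (hpos m).le) fun m _ =>
    min_le_norm_one_sub_exp (hL m) hR (hLR m) (hadm m) hs

end Admissible

/-! ### Perron's formula -/

section Kernel

variable {ι : Type*} {L : ι → ℝ} {δ : ℝ} [Fintype ι]

/-- The generating function `s ↦ exp (u s) / (s ∏ₘ (1 - exp (-(L m s))))` of the sums `∑ q m L m`,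
with `q : ι → ℕ`, weighted by Perron's kernel at `u`. With `L m = log (a m)` and `u = log x` it is
`kernel a x`. -/
noncomputable def expKernel (L : ι → ℝ) (u : ℝ) (s : ℂ) : ℂ :=
  exp (u * s) / (s * ∏ m, (1 - exp (-(L m * s))))

theorem analyticAt_expKernel {u : ℝ} {z : ℂ} (hz : z ≠ 0) (hz' : ∀ m, 1 - exp (-(L m * z)) ≠ 0) :
    AnalyticAt ℂ (expKernel L u) z := by
  refine AnalyticAt.fun_div (by fun_prop) (by fun_prop)
    (mul_ne_zero hz (Finset.prod_ne_zero_iff.2 fun m _ => hz' m))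

theorem norm_prod_one_sub_exp_mul (L : ι → ℝ) (s : ℂ) :
    ‖∏ m, (1 - exp (-(L m * -s)))‖
      = Real.exp ((∑ m, L m) * s.re) * ‖∏ m, (1 - exp (-(L m * s)))‖ := by
  rw [norm_prod, norm_prod, Finset.sum_mul, Real.exp_sum, ← Finset.prod_mul_distrib]
  refine Finset.prod_congr rfl fun m _ => ?_
  rw [← Complex.re_ofReal_mul, ← Complex.norm_exp, ← norm_mul, mul_sub, ← Complex.exp_add,
    add_neg_cancel, Complex.exp_zero, mul_one, mul_neg, neg_neg, norm_sub_rev]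

theorem tendsto_two_pi_mul_inf_principal (S : Set ℝ) :
    Tendsto (fun R => 2 * π * R) (atTop ⊓ 𝓟 S) atTop :=
  (tendsto_id.const_mul_atTop Real.two_pi_pos).mono_left inf_le_left

theorem tendsto_halfCircleIntegral_expKernel_neg (hL : ∀ m, 0 < L m) (hδ : 0 < δ) {u : ℝ}
    (hu : -∑ m, L m < u) :
    Tendsto (fun R => halfCircleIntegral (fun s => expKernel L u (-s)) (2 * π * R))
      (atTop ⊓ 𝓟 (admissibleFor L δ)) (𝓝 0) := by
  obtain ⟨g, hg, hprod⟩ := exists_forall_le_norm_prod_one_sub_exp hL hδ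
  have hT := tendsto_two_pi_mul_inf_principal (admissibleFor L δ)
  refine tendsto_halfCircleIntegral_zero hT (c := u + ∑ m, L m) (C := g⁻¹) (by linarith) ?_
  filter_upwards [hprod, hT.eventually_gt_atTop 0] with R hgR hR s hs
  have hs0 : ‖s‖ ≠ 0 := norm_ne_zero_iff.2 (ne_zero_of_mem_rightHalfCircle hR hs)
  rw [expKernel, norm_mul, norm_div, norm_mul, norm_neg, norm_prod_one_sub_exp_mul,
    Complex.norm_exp, Complex.re_ofReal_mul, Complex.neg_re]
  calc ‖s‖ * (Real.exp (u * -s.re) / (‖s‖ * (Real.exp ((∑ m, L m) * s.re)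
        * ‖∏ m, (1 - exp (-(L m * s)))‖)))
      = ‖∏ m, (1 - exp (-(L m * s)))‖⁻¹ * Real.exp (-((u + ∑ m, L m) * s.re)) := by
        rw [show -((u + ∑ m, L m) * s.re) = u * -s.re - (∑ m, L m) * s.re by ring, Real.exp_sub]
        generalize ‖∏ m, (1 - exp (-(L m * s)))‖ = w
        field_simp
    _ ≤ g⁻¹ * Real.exp (-((u + ∑ m, L m) * s.re)) := by
        gcongr
        exact hgR s hs

theorem norm_one_sub_prod_one_sub_le {f : ι → ℂ} {η : ℝ} (hη : η ≤ 1) (hf : ∀ m, ‖f m‖ ≤ η) :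
    ‖1 - ∏ m, (1 - f m)‖
      ≤ Fintype.card ι * Real.exp (Fintype.card ι) * η := by
  have hsum : ∑ m, ‖-f m‖ ≤ Fintype.card ι * η := by
    simpa using Finset.sum_le_card_nsmul Finset.univ (fun m => ‖-f m‖) η fun m _ => by
      simpa using hf m
  set x := ∑ m, ‖-f m‖
  have hx : 0 ≤ x := Finset.sum_nonneg fun m _ => norm_nonneg _
  have hcard : (0 : ℝ) ≤ Fintype.card ι := Nat.cast_nonneg _
  calc ‖1 - ∏ m, (1 - f m)‖ ≤ Real.exp x - 1 := by
        rw [norm_sub_rev]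
        simpa only [sub_eq_add_neg] using Finset.univ.norm_prod_one_add_sub_one_le (-f ·)
    _ ≤ x * Real.exp x := by
        have h := mul_le_mul_of_nonneg_right (Real.one_sub_le_exp_neg x) (Real.exp_pos x).le
        rw [← Real.exp_add, neg_add_cancel, Real.exp_zero] at h
        linarith
    _ ≤ (Fintype.card ι * η) * Real.exp (Fintype.card ι) := by
        gcongr
        · exact hx.trans hsum
        · exact hsum.trans (mul_le_of_le_one_right hcard hη)
    _ = Fintype.card ι * Real.exp (Fintype.card ι) * η := by ring

variable [DecidableEq ι]

theorem sum_exp_sub_mul (u : ℝ) {s : ℂ} (Q : ℕ)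
    (hs : ∀ m, 1 - exp (-(L m * s)) ≠ 0) :
    ∑ q ∈ Fintype.piFinset fun _ : ι => Finset.range Q, exp ((u - ∑ m, q m * L m : ℝ) * s)
      = exp (u * s) * (∏ m, (1 - exp (-(L m * s)) ^ Q)) / ∏ m, (1 - exp (-(L m * s))) := by
  have hgeom : ∀ m, ∑ j ∈ Finset.range Q, exp (-(L m * s)) ^ j
      = (1 - exp (-(L m * s)) ^ Q) / (1 - exp (-(L m * s))) := fun m => by
    rw [eq_div_iff (hs m), mul_comm, mul_neg_geom_sum]
  have hterm : ∀ q : ι → ℕ, exp ((u - ∑ m, q m * L m : ℝ) * s)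
      = exp (u * s) * ∏ m, exp (-(L m * s)) ^ q m := fun q => by
    simp_rw [← Complex.exp_nat_mul, ← Complex.exp_sum, ← Complex.exp_add]
    push_cast
    rw [sub_mul, Finset.sum_mul, sub_eq_add_neg, ← Finset.sum_neg_distrib]
    simp only [mul_neg, mul_assoc]
  simp only [hterm, ← Finset.mul_sum, mul_div_assoc, ← Finset.prod_div_distrib, ← hgeom,
    Finset.prod_univ_sum]

-- On the right half circle the truncation error `exp (-(L m s)) ^ Q` decays fast enough to absorb
-- the growth of `exp (u s)`.
theorem norm_mul_expKernel_sub_sum_le {u : ℝ} {Q : ℕ} (hQ : ∀ m, |u| + 1 ≤ Q * L m) {s : ℂ}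
    (hs : 0 ≤ s.re) (hs0 : s ≠ 0) {g : ℝ} (hg : 0 < g)
    (hgs : g ≤ ‖∏ m, (1 - exp (-(L m * s)))‖) :
    ‖s * (expKernel L u s - ∑ q ∈ Fintype.piFinset fun _ : ι => Finset.range Q,
        exp ((u - ∑ m, q m * L m : ℝ) * s) / s)‖
      ≤ g⁻¹ * (Fintype.card ι * Real.exp (Fintype.card ι)) * Real.exp (-(1 * s.re)) := by
  have hprod : ∏ m, (1 - exp (-(L m * s))) ≠ 0 := norm_pos_iff.1 (hg.trans_le hgs)
  have hdiff : s * (expKernel L u s - ∑ q ∈ Fintype.piFinset fun _ : ι => Finset.range Q,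
        exp ((u - ∑ m, q m * L m : ℝ) * s) / s)
      = (∏ m, (1 - exp (-(L m * s))))⁻¹ * (1 - ∏ m, (1 - exp (-(L m * s)) ^ Q)) * exp (u * s) := by
    rw [← Finset.sum_div, sum_exp_sub_mul u Q fun m =>
      Finset.prod_ne_zero_iff.1 hprod m (Finset.mem_univ m), expKernel]
    field_simp
  have hpow : ∀ m, ‖exp (-(L m * s)) ^ Q‖ ≤ Real.exp (-((|u| + 1) * s.re)) := fun m => by
    rw [norm_pow, Complex.norm_exp, Complex.neg_re, Complex.re_ofReal_mul, ← Real.exp_nat_mul,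
      Real.exp_le_exp, mul_neg, neg_le_neg_iff, ← mul_assoc]
    exact mul_le_mul_of_nonneg_right (hQ m) hs
  have hη : Real.exp (-((|u| + 1) * s.re)) ≤ 1 := by
    rw [Real.exp_le_one_iff, neg_nonpos]; positivity
  rw [hdiff, norm_mul, norm_mul, norm_inv, Complex.norm_exp, Complex.re_ofReal_mul]
  calc ‖∏ m, (1 - exp (-(L m * s)))‖⁻¹ * ‖1 - ∏ m, (1 - exp (-(L m * s)) ^ Q)‖
        * Real.exp (u * s.re)
      ≤ g⁻¹ * (Fintype.card ι * Real.exp (Fintype.card ι) * Real.exp (-((|u| + 1) * s.re)))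
        * Real.exp (|u| * s.re) := by
        gcongr
        · exact norm_one_sub_prod_one_sub_le hη hpow
        · exact le_abs_self u
    _ = g⁻¹ * (Fintype.card ι * Real.exp (Fintype.card ι)) * Real.exp (-(1 * s.re)) := by
        rw [show -(1 * s.re) = -((|u| + 1) * s.re) + |u| * s.re by ring, Real.exp_add]
        ring

theorem tendsto_halfCircleIntegral_expKernel (hL : ∀ m, 0 < L m) (hδ : 0 < δ) {u : ℝ} {Q : ℕ}
    (hQ : ∀ m, |u| + 1 ≤ Q * L m) :
    Tendsto (fun R => halfCircleIntegral (expKernel L u) (2 * π * R))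
      (atTop ⊓ 𝓟 (admissibleFor L δ)) (𝓝 (2 * π * I *
        ∑ q ∈ Fintype.piFinset fun _ : ι => Finset.range Q, (heaviside (u - ∑ m, q m * L m) : ℂ)))
        := by
  obtain ⟨g, hg, hprod⟩ := exists_forall_le_norm_prod_one_sub_exp hL hδ
  have hT := tendsto_two_pi_mul_inf_principal (admissibleFor L δ)
  set P := Fintype.piFinset fun _ : ι => Finset.range Q
  have hmain : Tendsto (fun R => ∑ q ∈ P,
      halfCircleIntegral (fun s => exp ((u - ∑ m, q m * L m : ℝ) * s) / s) (2 * π * R))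
      (atTop ⊓ 𝓟 (admissibleFor L δ))
      (𝓝 (2 * π * I * ∑ q ∈ P, (heaviside (u - ∑ m, q m * L m) : ℂ))) := by
    rw [Finset.mul_sum]
    exact tendsto_finsetSum _ fun q _ => (tendsto_halfCircleIntegral_exp_div _).comp hT
  have herror := tendsto_halfCircleIntegral_zero hT zero_lt_one <| by
    filter_upwards [hprod, hT.eventually_gt_atTop 0] with R hgR hR s hs
    exact norm_mul_expKernel_sub_sum_le hQ hs.2 (ne_zero_of_mem_rightHalfCircle hR hs) hg (hgR s hs)
  rw [← zero_add (2 * π * I * _)]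
  refine (herror.add hmain).congr' ?_
  filter_upwards [hprod, hT.eventually_gt_atTop 0] with R hgR hR
  have hterm : ∀ q ∈ P, ContinuousOn (fun s : ℂ => exp ((u - ∑ m, q m * L m : ℝ) * s) / s)
      (rightHalfCircle (2 * π * R)) := fun q _ =>
    (continuousOn_exp_div _).mono fun s hs => ne_zero_of_mem_rightHalfCircle hR hs
  have hkernel : ContinuousOn (expKernel L u) (rightHalfCircle (2 * π * R)) := fun s hs =>
    (analyticAt_expKernel (ne_zero_of_mem_rightHalfCircle hR hs) fun m =>
      Finset.prod_ne_zero_iff.1 (norm_pos_iff.1 (hg.trans_le (hgR s hs))) m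
        (Finset.mem_univ m)).continuousAt.continuousWithinAt
  rw [halfCircleIntegral_sub hR.le hkernel (continuousOn_finsetSum P hterm),
    halfCircleIntegral_sum hR.le hterm, sub_add_cancel]

end Kernel

/-- The zero `2πik / l` of `1 - exp (-l s)`. -/
noncomputable def pole (l : ℝ) (k : ℤ) : ℂ :=
  (2 * π * k / l : ℝ) * I

theorem norm_pole {l : ℝ} (hl : 0 < l) (k : ℤ) : ‖pole l k‖ = 2 * π * |k| / l := by
  rw [pole, norm_mul, Complex.norm_I, mul_one, Complex.norm_real, Real.norm_eq_abs, abs_div,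
    abs_mul, abs_of_pos hl, abs_of_pos Real.two_pi_pos, Int.cast_abs]

theorem pole_mul_self {l : ℝ} (hl : l ≠ 0) (k : ℤ) : pole l k * l = 2 * π * k * I := by
  have : (l : ℂ) ≠ 0 := Complex.ofReal_ne_zero.2 hl
  rw [pole]
  push_cast
  field_simp

theorem conj_pole (l : ℝ) (k : ℤ) : conj (pole l k) = pole l (-k) := by
  rw [pole, pole, map_mul, Complex.conj_ofReal, Complex.conj_I]
  push_cast
  ring

theorem pole_injective {l : ℝ} (hl : l ≠ 0) : Function.Injective (pole l) := by
  intro k k' h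
  have h' := congrArg (· * (l : ℂ)) h
  simp only [pole_mul_self hl] at h'
  simpa [Real.pi_ne_zero] using h'

theorem pole_ne_zero {l : ℝ} (hl : l ≠ 0) {k : ℤ} (hk : k ≠ 0) : pole l k ≠ 0 := by
  have : pole l 0 = 0 := by simp [pole]
  exact this ▸ (pole_injective hl).ne hk

theorem one_sub_exp_eq_zero_iff {l : ℝ} (hl : l ≠ 0) {s : ℂ} :
    1 - exp (-(l * s)) = 0 ↔ ∃ k : ℤ, s = pole l k := by
  have hl' : (l : ℂ) ≠ 0 := Complex.ofReal_ne_zero.2 hl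
  rw [sub_eq_zero, eq_comm, Complex.exp_neg, inv_eq_one, Complex.exp_eq_one_iff]
  refine exists_congr fun k => ?_
  rw [← mul_left_inj' (a := s) hl', pole_mul_self hl, mul_comm s]
  ring_nf

theorem pole_ne_pole_of_irrational {l l' : ℝ} (h : Irrational (l / l')) {k : ℤ} (hk : k ≠ 0)
    (k' : ℤ) : pole l k ≠ pole l' k' := by
  have hl : l ≠ 0 := fun h0 => h.ne_zero (by rw [h0, zero_div])
  have hl' : l' ≠ 0 := fun h0 => h.ne_zero (by rw [h0, div_zero])
  intro heq
  rw [pole, pole, mul_left_inj' Complex.I_ne_zero, Complex.ofReal_inj, div_eq_div_iff hl hl',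
    mul_assoc, mul_assoc (2 * π), mul_right_inj' Real.two_pi_pos.ne'] at heq
  have hk' : (k' : ℝ) ≠ 0 := by
    rintro h0
    simp [h0, hk, hl'] at heq
  refine (irrational_iff_ne_rational _).1 h k k' (by exact_mod_cast hk') ?_
  rw [div_eq_div_iff hl' hk', heq, mul_comm]

section Perron

variable {ι : Type*} {L : ι → ℝ} {δ R : ℝ}

theorem abs_ne_of_mem_admissibleFor (hδ : 0 < δ) (hR : R ∈ admissibleFor L δ) (m : ι) (k : ℤ) :
    (|k| : ℝ) ≠ R * L m := fun h => by
  have := hR m |k|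
  rw [Int.cast_abs, h, sub_self, abs_zero] at this
  exact this.not_gt hδ

theorem norm_pole_ne_of_mem_admissibleFor (hL : ∀ m, 0 < L m) (hδ : 0 < δ)
    (hR : R ∈ admissibleFor L δ) (m : ι) (k : ℤ) : ‖pole (L m) k‖ ≠ 2 * π * R := fun h => by
  rw [norm_pole (hL m), div_eq_iff (hL m).ne', mul_assoc _ R,
    mul_right_inj' Real.two_pi_pos.ne'] at h
  exact abs_ne_of_mem_admissibleFor hδ hR m k (by exact_mod_cast h)

variable [Fintype ι]

theorem continuousOn_expKernel_sphere (hL : ∀ m, 0 < L m) (hδ : 0 < δ) (hR0 : 0 < R)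
    (hR : R ∈ admissibleFor L δ) (u : ℝ) :
    ContinuousOn (expKernel L u) (sphere 0 (2 * π * R)) := fun z hz => by
  rw [mem_sphere_zero_iff_norm] at hz
  refine (analyticAt_expKernel (fun h => ?_) fun m h => ?_).continuousAt.continuousWithinAt
  · rw [h, norm_zero] at hz
    exact (mul_pos Real.two_pi_pos hR0).ne hz
  · obtain ⟨k, rfl⟩ := (one_sub_exp_eq_zero_iff (hL m).ne').1 h
    exact norm_pole_ne_of_mem_admissibleFor hL hδ hR m k hz

theorem lt_of_sum_mul_le {u : ℝ} (hL : ∀ m, 0 < L m) {Q : ℕ} (hQ : ∀ m, |u| + 1 ≤ Q * L m)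
    {q : ι → ℕ} (hq : ∑ m, q m * L m ≤ u) (m : ι) : q m < Q := by
  have hle : q m * L m ≤ ∑ l, q l * L l :=
    Finset.single_le_sum (f := fun l => q l * L l)
      (fun l _ => mul_nonneg (Nat.cast_nonneg _) (hL l).le) (Finset.mem_univ m)
  have : (q m : ℝ) < Q := lt_of_mul_lt_mul_right
    (by linarith [hQ m, le_abs_self u]) (hL m).le
  exact_mod_cast this

theorem tendsto_circleIntegral_expKernel (hL : ∀ m, 0 < L m) (hδ : 0 < δ) {u : ℝ}
    (hu : -∑ m, L m < u) :
    Tendsto (fun R : ℝ => (2 * π * I)⁻¹ * ∮ z in C(0, 2 * π * R), expKernel L u z)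
      (atTop ⊓ 𝓟 (admissibleFor L δ))
      (𝓝 (({q : ι → ℕ | ∑ m, q m * L m ≤ u}.ncard
        - 1 / 2 * {q : ι → ℕ | ∑ m, q m * L m = u}.ncard : ℝ) : ℂ)) := by
  classical
  obtain ⟨Q, hQ⟩ : ∃ Q : ℕ, ∀ m, |u| + 1 ≤ Q * L m := by
    have h : ∀ᶠ Q : ℕ in atTop, ∀ m, |u| + 1 ≤ Q * L m := eventually_all.2 fun m =>
      (tendsto_natCast_atTop_atTop.atTop_mul_const (hL m)).eventually_ge_atTop _
    exact h.exists
  have hbox : ∀ q : ι → ℕ, ∑ m, q m * L m ≤ u →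
      q ∈ Fintype.piFinset fun _ : ι => Finset.range Q := fun q hq =>
    Fintype.mem_piFinset.2 fun m => Finset.mem_range.2 (lt_of_sum_mul_le hL hQ hq m)
  have hlim := ((tendsto_halfCircleIntegral_expKernel hL hδ hQ).sub
    (tendsto_halfCircleIntegral_expKernel_neg hL hδ hu)).const_mul (2 * π * I)⁻¹
  rw [sub_zero, inv_mul_cancel_left₀ Complex.two_pi_I_ne_zero, ← Complex.ofReal_sum,
    sum_heaviside_sub hbox] at hlim
  refine hlim.congr' ?_
  filter_upwards [mem_inf_of_left (eventually_gt_atTop 0),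
    eventually_mem_admissibleFor] with R hR0 hR
  rw [circleIntegral_eq_halfCircleIntegral_sub (by positivity)
    (continuousOn_expKernel_sphere hL hδ hR0 hR u)]

end Perron

/-! ### Residues at the nonzero poles -/

theorem one_sub_exp_pole_ne_zero {l l' : ℝ} (h : Irrational (l / l')) {k : ℤ} (hk : k ≠ 0) :
    1 - exp (-(l' * pole l k)) ≠ 0 := fun h0 => by
  have hl' : l' ≠ 0 := fun h0 => h.ne_zero (by rw [h0, div_zero])
  obtain ⟨k', hk'⟩ := (one_sub_exp_eq_zero_iff hl').1 h0
  exact pole_ne_pole_of_irrational h hk k' hk'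

theorem one_sub_exp_pole_self {l : ℝ} (hl : l ≠ 0) (k : ℤ) : 1 - exp (-(l * pole l k)) = 0 :=
  (one_sub_exp_eq_zero_iff hl).2 ⟨k, rfl⟩

/-- The nonzero zeros of `1 - exp (-l s)` in the closed disc of radius `2πR` around the origin. -/
noncomputable def nonzeroPoles (l R : ℝ) : Finset ℂ :=
  ((Finset.Icc (-⌊R * l⌋₊ : ℤ) ⌊R * l⌋₊).erase 0).image (pole l)

theorem mem_nonzeroPoles {l R : ℝ} (hl : 0 < l) (hR : 0 ≤ R) {z : ℂ} :
    z ∈ nonzeroPoles l R ↔ z ≠ 0 ∧ ‖z‖ ≤ 2 * π * R ∧ 1 - exp (-(l * z)) = 0 := by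
  have hnorm : ∀ k : ℤ, ‖pole l k‖ ≤ 2 * π * R ↔ k ∈ Finset.Icc (-⌊R * l⌋₊ : ℤ) ⌊R * l⌋₊ :=
    fun k => by
      rw [norm_pole hl, div_le_iff₀ hl, mul_assoc _ R, mul_le_mul_iff_right₀ Real.two_pi_pos,
        ← Int.natCast_natAbs, Int.cast_natCast, ← Nat.le_floor_iff (by positivity),
        Finset.mem_Icc, ← abs_le, Int.abs_eq_natAbs, Int.ofNat_le]
  simp only [nonzeroPoles, Finset.mem_image, Finset.mem_erase, one_sub_exp_eq_zero_iff hl.ne',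
    ← hnorm]
  constructor
  · rintro ⟨k, ⟨hk, hkR⟩, rfl⟩
    exact ⟨pole_ne_zero hl.ne' hk, hkR, k, rfl⟩
  · rintro ⟨hz, hzR, k, rfl⟩
    exact ⟨k, ⟨fun hk => hz (by simp [hk, pole]), hzR⟩, rfl⟩

theorem sum_Icc_neg_erase_zero {M : Type*} [AddCommMonoid M] (f : ℤ → M) (K : ℕ) :
    ∑ k ∈ (Finset.Icc (-(K : ℤ)) K).erase 0, f k
      = ∑ k ∈ Finset.Icc 1 K, (f k + f (-(k : ℤ))) := by
  induction K with
  | zero => simp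
  | succ K ih =>
    have h : (Finset.Icc (-((K + 1 : ℕ) : ℤ)) ((K + 1 : ℕ) : ℤ)).erase 0
        = insert ((K + 1 : ℕ) : ℤ) (insert (-((K + 1 : ℕ) : ℤ))
          ((Finset.Icc (-(K : ℤ)) K).erase 0)) := by
      ext k
      simp only [Finset.mem_erase, Finset.mem_Icc, Finset.mem_insert]
      omega
    rw [h, Finset.sum_insert (by simp; omega), Finset.sum_insert (by simp), ih,
      Finset.sum_Icc_succ_top (by omega), ← add_assoc, add_comm]

theorem sum_nonzeroPoles {M : Type*} [AddCommMonoid M] {l : ℝ} (hl : l ≠ 0) (R : ℝ) (f : ℂ → M) :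
    ∑ p ∈ nonzeroPoles l R, f p
      = ∑ k ∈ Finset.Icc 1 ⌊R * l⌋₊, (f (pole l k) + f (pole l (-(k : ℤ)))) := by
  rw [nonzeroPoles, Finset.sum_image (pole_injective hl).injOn, sum_Icc_neg_erase_zero]

theorem inv_one_sub_exp_eq {θ : ℝ} (hθ : 1 - exp (-(2 * θ * I)) ≠ 0) :
    (1 - exp (-(2 * θ * I)))⁻¹ = 2⁻¹ * (1 + -I * Real.cot θ) := by
  set E := exp (2 * I * θ) with hE
  have hE0 : E ≠ 0 := Complex.exp_ne_zero _
  have hinv : exp (-(2 * θ * I)) = E⁻¹ := by rw [Complex.exp_neg, mul_right_comm]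
  have hE1 : 1 - E ≠ 0 := by
    intro h
    rw [hinv, ← sub_eq_zero.1 h, inv_one, sub_self] at hθ
    exact hθ rfl
  have hI := Complex.I_ne_zero
  rw [Complex.ofReal_cot, Complex.cot_eq_exp_ratio, hinv, ← hE]
  refine inv_eq_of_mul_eq_one_right ?_
  field_simp
  ring

theorem exp_mul_I_mul_neg_I_pow (θ : ℝ) (r : ℕ) :
    exp (θ * I) * (-I) ^ r = exp ((θ - π * r / 2 : ℝ) * I) := by
  have : -I = exp (-(π / 2) * I) := by
    rw [neg_mul, Complex.exp_neg, Complex.exp_pi_div_two_mul_I, Complex.inv_I]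
  rw [this, ← Complex.exp_nat_mul, ← Complex.exp_add]
  congr 1
  push_cast
  ring

section CotangentResidues

variable {ι : Type*} {L : ι → ℝ} {δ R : ℝ}

theorem pairwiseDisjoint_nonzeroPoles (hi : Pairwise fun m l => Irrational (L m / L l)) (R : ℝ)
    (S : Set ι) : S.PairwiseDisjoint fun m => nonzeroPoles (L m) R := by
  intro m _ l _ hml
  simp only [Function.onFun, Finset.disjoint_left, nonzeroPoles, Finset.mem_image]
  rintro _ ⟨k, hk, rfl⟩ ⟨k', -, h⟩
  exact pole_ne_pole_of_irrational (hi hml) (Finset.ne_of_mem_erase hk) k' h.symm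

variable [Fintype ι]

theorem residue_expKernel_pole [DecidableEq ι] (hi : Pairwise fun m l => Irrational (L m / L l))
    (u : ℝ) {m : ι} (hm : L m ≠ 0) {k : ℤ} (hk : k ≠ 0) :
    residue (expKernel L u) (pole (L m) k) = exp (u * pole (L m) k) / (2 * π * k * I) *
      ∏ l ∈ Finset.univ.erase m, (1 - exp (-(L l * pole (L m) k)))⁻¹ := by
  set p := pole (L m) k with hp
  have hp0 : p ≠ 0 := pole_ne_zero hm hk
  have hprod : ∏ l ∈ Finset.univ.erase m, (1 - exp (-(L l * p))) ≠ 0 :=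
    Finset.prod_ne_zero_iff.2 fun l hl =>
      one_sub_exp_pole_ne_zero (hi (Finset.ne_of_mem_erase hl).symm) hk
  have hsplit : expKernel L u = fun s => exp (u * s) / (s * ∏ l ∈ Finset.univ.erase m,
      (1 - exp (-(L l * s)))) / (1 - exp (-(L m * s))) := by
    funext s
    rw [expKernel, div_div, mul_assoc, Finset.prod_erase_mul _ _ (Finset.mem_univ m)]
  have hderiv : HasDerivAt (fun s : ℂ => 1 - exp (-(L m * s))) (L m) p := by
    have h := (((hasDerivAt_id p).const_mul (L m : ℂ)).neg.cexp).const_sub 1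
    have hexp : exp (-(L m * p)) = 1 := (sub_eq_zero.1 (one_sub_exp_pole_self hm k)).symm
    simpa [hexp] using h
  have hquot : AnalyticAt ℂ
      (fun s => exp (u * s) / (s * ∏ l ∈ Finset.univ.erase m, (1 - exp (-(L l * s))))) p :=
    AnalyticAt.fun_div (by fun_prop) (by fun_prop) (mul_ne_zero hp0 hprod)
  rw [hsplit, residue_div hquot (by fun_prop) (one_sub_exp_pole_self hm k)
    (by rw [hderiv.deriv]; exact Complex.ofReal_ne_zero.2 hm), hderiv.deriv, div_div,
    mul_right_comm, hp, pole_mul_self hm, ← hp, ← div_div, Finset.prod_inv_distrib,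
    ← div_eq_mul_inv]

theorem residue_expKernel_pole_neg (hi : Pairwise fun m l => Irrational (L m / L l)) (u : ℝ)
    {m : ι} (hm : L m ≠ 0) {k : ℤ} (hk : k ≠ 0) :
    residue (expKernel L u) (pole (L m) (-k)) = conj (residue (expKernel L u) (pole (L m) k)) := by
  classical
  rw [residue_expKernel_pole hi u hm hk, residue_expKernel_pole hi u hm (neg_ne_zero.2 hk)]
  simp only [map_mul, map_div₀, map_prod, map_inv₀, map_sub, map_one, ← Complex.exp_conj, map_neg,
    conj_pole, Complex.conj_ofReal, Complex.conj_I, map_ofNat, map_intCast, Int.cast_neg, mul_neg,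
    neg_mul]

variable [DecidableEq ι]

theorem residue_expKernel_pole_eq_sum (hi : Pairwise fun m l => Irrational (L m / L l)) (u : ℝ)
    {m : ι} (hm : L m ≠ 0) {k : ℕ} (hk : k ≠ 0) :
    residue (expKernel L u) (pole (L m) k) = ∑ t ∈ (Finset.univ.erase m).powerset,
      (((∏ l ∈ t, Real.cot (π * k * L l / L m)) / (2 ^ (Fintype.card ι - 1) * (2 * π * k)) : ℝ) : ℂ)
        * (-I * exp ((2 * π * k * (u / L m) - π * (t.card : ℝ) / 2 : ℝ) * I)) := by
  have hcot : ∀ l ∈ Finset.univ.erase m, (1 - exp (-(L l * pole (L m) k)))⁻¹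
      = 2⁻¹ * (1 + -I * Real.cot (π * k * L l / L m)) := fun l hl => by
    have harg : -(L l * pole (L m) k) = -(2 * (π * k * L l / L m : ℝ) * I) := by
      rw [pole]
      push_cast
      ring
    have hne := one_sub_exp_pole_ne_zero (hi (Finset.ne_of_mem_erase hl).symm)
      (Int.natCast_ne_zero.2 hk)
    rw [harg] at hne ⊢
    exact inv_one_sub_exp_eq hne
  have hphase : u * pole (L m) k = (2 * π * k * (u / L m) : ℝ) * I := by
    rw [pole]
    push_cast
    ring
  rw [residue_expKernel_pole hi u hm (Int.natCast_ne_zero.2 hk), Finset.prod_congr rfl hcot,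
    Finset.prod_mul_distrib, Finset.prod_const, Finset.card_erase_of_mem (Finset.mem_univ m),
    Finset.card_univ, Finset.prod_one_add, Finset.mul_sum, Finset.mul_sum, hphase]
  refine Finset.sum_congr rfl fun t _ => ?_
  rw [Finset.prod_mul_distrib, Finset.prod_const, ← exp_mul_I_mul_neg_I_pow, ← Complex.ofReal_prod]
  generalize ∏ l ∈ t, Real.cot (π * k * L l / L m) = c
  generalize exp ((2 * π * k * (u / L m) : ℝ) * I) = e
  have hk' : (k : ℂ) ≠ 0 := Nat.cast_ne_zero.2 hk
  have hpi : (π : ℂ) ≠ 0 := Complex.ofReal_ne_zero.2 Real.pi_ne_zero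
  have hI := Complex.I_ne_zero
  push_cast
  rw [div_eq_mul_inv, mul_inv _ I, Complex.inv_I, inv_pow]
  field_simp

/-- The partial sum up to `⌊R L m⌋` of the series attached to `m` and to the further indices `t`;
with `L = log ∘ a` it is `partialSeries`. -/
noncomputable def trigPartialSum (L : ι → ℝ) (u : ℝ) (m : ι) (t : Finset ι) (R : ℝ) : ℝ :=
  ∑ k ∈ Finset.Icc 1 ⌊R * L m⌋₊,
    Real.sin (2 * π * k * (u / L m) - π * (t.card : ℝ) / 2) / k *
      ∏ l ∈ t, Real.cot (π * k * L l / L m)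

theorem residue_add_residue_neg (hi : Pairwise fun m l => Irrational (L m / L l)) (u : ℝ)
    {m : ι} (hm : L m ≠ 0) {k : ℕ} (hk : k ≠ 0) :
    residue (expKernel L u) (pole (L m) k) + residue (expKernel L u) (pole (L m) (-(k : ℤ)))
      = ((1 / (2 ^ (Fintype.card ι - 1) * π) * ∑ t ∈ (Finset.univ.erase m).powerset,
        Real.sin (2 * π * k * (u / L m) - π * (t.card : ℝ) / 2) / k
          * ∏ l ∈ t, Real.cot (π * k * L l / L m) : ℝ) : ℂ) := by
  rw [residue_expKernel_pole_neg hi u hm (Int.natCast_ne_zero.2 hk), Complex.add_conj,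
    residue_expKernel_pole_eq_sum hi u hm hk, Complex.re_sum, Finset.mul_sum, Finset.mul_sum]
  refine congrArg _ (Finset.sum_congr rfl fun t _ => ?_)
  rw [Complex.re_ofReal_mul, neg_mul, Complex.neg_re, Complex.I_mul_re,
    Complex.exp_ofReal_mul_I_im, neg_neg]
  have hk' : (k : ℝ) ≠ 0 := Nat.cast_ne_zero.2 hk
  have := Real.pi_ne_zero
  field_simp

theorem sum_residue_nonzeroPoles (hi : Pairwise fun m l => Irrational (L m / L l)) (u R : ℝ)
    {m : ι} (hm : L m ≠ 0) :
    ∑ p ∈ nonzeroPoles (L m) R, residue (expKernel L u) p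
      = ((1 / (2 ^ (Fintype.card ι - 1) * π) *
          ∑ t ∈ (Finset.univ.erase m).powerset, trigPartialSum L u m t R : ℝ) : ℂ) := by
  simp only [sum_nonzeroPoles hm, trigPartialSum]
  rw [Finset.sum_comm, Finset.mul_sum, Complex.ofReal_sum]
  exact Finset.sum_congr rfl fun k hk =>
    residue_add_residue_neg hi u hm (Nat.one_le_iff_ne_zero.1 (Finset.mem_Icc.1 hk).1)

theorem circleIntegral_expKernel (hL : ∀ m, 0 < L m)
    (hi : Pairwise fun m l => Irrational (L m / L l)) (u : ℝ) (hδ : 0 < δ) (hR0 : 0 < R)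
    (hR : R ∈ admissibleFor L δ) :
    (2 * π * I)⁻¹ * (∮ z in C(0, 2 * π * R), expKernel L u z)
      = residue (expKernel L u) 0 + ((1 / (2 ^ (Fintype.card ι - 1) * π) *
          ∑ m, ∑ t ∈ (Finset.univ.erase m).powerset, trigPartialSum L u m t R : ℝ) : ℂ) := by
  set P := Finset.univ.biUnion fun m => nonzeroPoles (L m) R with hP
  have hmem : ∀ z, z ∈ P ↔ ∃ m, z ≠ 0 ∧ ‖z‖ ≤ 2 * π * R ∧ 1 - exp (-(L m * z)) = 0 := fun z => by
    simp only [hP, Finset.mem_biUnion, Finset.mem_univ, true_and, mem_nonzeroPoles (hL _) hR0.le]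
  have hball : ↑(insert 0 P) ⊆ ball (0 : ℂ) (2 * π * R) := by
    rw [Finset.coe_insert, Set.insert_subset_iff]
    refine ⟨mem_ball_self (by positivity), fun z hz => ?_⟩
    obtain ⟨m, -, hzR, hzm⟩ := (hmem z).1 hz
    obtain ⟨k, rfl⟩ := (one_sub_exp_eq_zero_iff (hL m).ne').1 hzm
    exact mem_ball_zero_iff.2 (hzR.lt_of_ne (norm_pole_ne_of_mem_admissibleFor hL hδ hR m k))
  have hanalytic : ∀ z ∈ closedBall 0 (2 * π * R), z ∉ insert 0 P →
      AnalyticAt ℂ (expKernel L u) z := fun z hz hzP => by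
    rw [Finset.mem_insert, not_or, hmem] at hzP
    exact analyticAt_expKernel hzP.1 fun m hm =>
      hzP.2 ⟨m, hzP.1, mem_closedBall_zero_iff.1 hz, hm⟩
  have hmer : ∀ z ∈ insert 0 P, MeromorphicAt (expKernel L u) z := fun z _ => by
    unfold expKernel
    fun_prop
  have h0 : (0 : ℂ) ∉ P := fun h => ((hmem 0).1 h).elim fun _ h => h.1 rfl
  rw [circleIntegral_eq_sum_residue (by positivity) hball hmer hanalytic,
    inv_mul_cancel_left₀ Complex.two_pi_I_ne_zero, Finset.sum_insert h0, hP,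
    Finset.sum_biUnion (pairwiseDisjoint_nonzeroPoles hi R _), Finset.mul_sum, Complex.ofReal_sum]
  simp only [sum_residue_nonzeroPoles hi u R (hL _).ne']

end CotangentResidues

/-! ### The Fourier series of the sawtooth function -/

theorem exists_tendsto_sum_pow_div {z : ℂ} (hz : ‖z‖ = 1) (hz1 : z ≠ 1) :
    ∃ ℓ, Tendsto (fun N : ℕ => ∑ i ∈ Finset.range N, z ^ i / i) atTop (𝓝 ℓ) := by
  have hcauchy : CauchySeq fun N : ℕ => ∑ i ∈ Finset.range N, (1 / ((i : ℝ) + 1)) • z ^ i := by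
    refine Antitone.cauchySeq_series_mul_of_tendsto_zero_of_bounded (b := 2 / ‖z - 1‖)
      (fun i j hij => ?_) tendsto_one_div_add_atTop_nhds_zero_nat fun N => ?_
    · gcongr
    · rw [geom_sum_eq hz1, norm_div]
      gcongr
      refine (norm_sub_le _ _).trans ?_
      rw [norm_pow, hz, one_pow, norm_one]
      norm_num
  obtain ⟨ℓ, hℓ⟩ := cauchySeq_tendsto_of_complete hcauchy
  refine ⟨z * ℓ, (tendsto_add_atTop_iff_nat 1).1 ((hℓ.const_mul z).congr fun N => ?_)⟩
  rw [Finset.sum_range_succ', Finset.mul_sum, Nat.cast_zero, div_zero, add_zero]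
  refine Finset.sum_congr rfl fun i _ => ?_
  rw [Complex.real_smul]
  push_cast
  ring

theorem one_sub_mem_slitPlane {z : ℂ} (hz : ‖z‖ ≤ 1) (hz1 : z ≠ 1) :
    1 - z ∈ Complex.slitPlane := by
  have hre : z.re ≤ 1 := (Complex.re_le_norm z).trans hz
  refine Complex.mem_slitPlane_iff.2 ?_
  by_contra! h
  simp only [Complex.sub_re, Complex.one_re, Complex.sub_im, Complex.one_im, zero_sub,
    neg_eq_zero, sub_nonpos] at h
  exact hz1 (Complex.ext (hre.antisymm h.1) h.2)

-- The limit exists by Dirichlet's test; Abel's limit theorem identifies it.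
theorem tendsto_sum_pow_div {z : ℂ} (hz : ‖z‖ = 1) (hz1 : z ≠ 1) :
    Tendsto (fun N : ℕ => ∑ i ∈ Finset.range N, z ^ i / i) atTop (𝓝 (-Complex.log (1 - z))) := by
  obtain ⟨ℓ, hℓ⟩ := exists_tendsto_sum_pow_div hz hz1
  have habel := Complex.tendsto_tsum_powerSeries_nhdsWithin_lt hℓ
  rw [tendsto_map'_iff] at habel
  have hlog : Tendsto (fun r : ℝ => -Complex.log (1 - r * z)) (𝓝[<] 1)
      (𝓝 (-Complex.log (1 - z))) := by
    have hcont : ContinuousAt (fun r : ℝ => -Complex.log (1 - r * z)) 1 :=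
      (ContinuousAt.clog (by fun_prop) (by simpa using one_sub_mem_slitPlane hz.le hz1)).neg
    simpa using hcont.tendsto.mono_left nhdsWithin_le_nhds
  rwa [tendsto_nhds_unique habel (hlog.congr' ?_)] at hℓ
  filter_upwards [Ioo_mem_nhdsLT (zero_lt_one' ℝ)] with r hr
  have hrz : ‖(r : ℂ) * z‖ < 1 := by
    rw [norm_mul, hz, mul_one, Complex.norm_real, Real.norm_of_nonneg hr.1.le]
    exact hr.2
  rw [Function.comp_apply, ← (Complex.hasSum_taylorSeries_neg_log hrz).tsum_eq]
  refine tsum_congr fun i => ?_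
  rw [mul_pow]
  ring

theorem arg_one_sub_exp {t : ℝ} (h0 : 0 < t) (h1 : t < 1) :
    (1 - exp ((2 * π * t : ℝ) * I)).arg = π * t - π / 2 := by
  have hpi := Real.pi_pos
  have hsin : 0 < Real.sin (π * t) :=
    Real.sin_pos_of_pos_of_lt_pi (by positivity) (by nlinarith)
  have hpolar : 1 - exp ((2 * π * t : ℝ) * I) = ((2 * Real.sin (π * t) : ℝ) : ℂ) *
      (Complex.cos (π * t - π / 2 : ℝ) + Complex.sin (π * t - π / 2 : ℝ) * I) := by
    rw [← Complex.ofReal_cos, ← Complex.ofReal_sin, Real.cos_sub_pi_div_two,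
      Real.sin_sub_pi_div_two, Complex.exp_mul_I, ← Complex.ofReal_cos, ← Complex.ofReal_sin,
      mul_assoc 2 π, Real.cos_two_mul', Real.sin_two_mul]
    push_cast
    linear_combination -Complex.sin_sq_add_cos_sq (π * t)
  rw [hpolar, Complex.arg_mul_cos_add_sin_mul_I (by positivity)]
  constructor <;> nlinarith

theorem exp_two_pi_mul_I_ne_one {t : ℝ} (h0 : 0 < t) (h1 : t < 1) :
    exp ((2 * π * t : ℝ) * I) ≠ 1 := fun h => by
  obtain ⟨k, hk⟩ := Complex.exp_eq_one_iff.1 h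
  have htk : t = k := by
    have hk' : (2 * π * t : ℝ) * I = ((2 * π * k : ℝ) : ℂ) * I := by
      rw [hk]
      push_cast
      ring
    rwa [mul_left_inj' Complex.I_ne_zero, Complex.ofReal_inj,
      mul_right_inj' Real.two_pi_pos.ne'] at hk'
  rw [htk] at h0 h1
  norm_cast at h0 h1
  omega

theorem tendsto_sum_sin_div_of_mem_Ioo {t : ℝ} (h0 : 0 < t) (h1 : t < 1) :
    Tendsto (fun N : ℕ => ∑ k ∈ Finset.Icc 1 N, Real.sin (2 * π * k * t) / k) atTop
      (𝓝 (-(π * t - π / 2))) := by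
  set z := exp ((2 * π * t : ℝ) * I) with hz
  have him : ∀ k : ℕ, (z ^ k / k).im = Real.sin (2 * π * k * t) / k := fun k => by
    rw [hz, ← Complex.exp_nat_mul, ← Complex.ofReal_natCast, Complex.div_ofReal_im, ← mul_assoc,
      ← Complex.ofReal_mul, Complex.exp_ofReal_mul_I_im, ← mul_assoc, mul_comm (k : ℝ)]
  have hlim := (Complex.continuous_im.tendsto _).comp ((tendsto_sum_pow_div
    (Complex.norm_exp_ofReal_mul_I _) (exp_two_pi_mul_I_ne_one h0 h1)).comp
      (tendsto_add_atTop_nat 1))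
  rw [Complex.neg_im, Complex.log_im, arg_one_sub_exp h0 h1] at hlim
  refine hlim.congr fun N => ?_
  rw [Function.comp_apply, Function.comp_apply, Complex.im_sum,
    Finset.sum_range_eq_add_Ico _ N.succ_pos, him, Nat.cast_zero, div_zero, zero_add]
  exact Finset.sum_congr (Finset.Ico_add_one_right_eq_Icc 1 N) fun k _ => him k

theorem tendsto_sum_sin_div (y : ℝ) :
    Tendsto (fun N : ℕ => ∑ k ∈ Finset.Icc 1 N, Real.sin (2 * π * k * y) / k) atTop
      (𝓝 (-π * B1star y)) := by
  have hfract : ∀ k : ℕ, Real.sin (2 * π * k * y) = Real.sin (2 * π * k * Int.fract y) :=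
    fun k => by
      rw [← Real.sin_sub_int_mul_two_pi _ (k * ⌊y⌋), Int.fract]
      push_cast
      ring_nf
  simp only [hfract]
  by_cases hy : Int.fract y = 0
  · simp [hy, B1star]
  · rw [B1star, if_neg hy, show -π * (Int.fract y - 1 / 2) = -(π * Int.fract y - π / 2) by ring]
    exact tendsto_sum_sin_div_of_mem_Ioo ((Int.fract_nonneg y).lt_of_ne' hy) (Int.fract_lt_one y)

/-! ### Density of the admissible parameters -/

theorem volume_near_int_le {l δ T : ℝ} (hl : 0 < l) (hδ : 0 ≤ δ) (hT : 0 ≤ T) :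
    MeasureTheory.volume {R ∈ Set.Icc 0 T | ∃ k : ℤ, |R * l - k| < δ}
      ≤ ENNReal.ofReal (2 * δ * T + (2 * δ + 1) * (2 * δ / l)) := by
  have hcover : {R ∈ Set.Icc 0 T | ∃ k : ℤ, |R * l - k| < δ} ⊆
      ⋃ k ∈ Finset.Icc ⌈-δ⌉ ⌊T * l + δ⌋, Set.Ioo ((k - δ) / l) ((k + δ) / l) := by
    rintro R ⟨⟨hR0, hRT⟩, k, hk⟩
    rw [abs_lt] at hk
    have h0 : 0 ≤ R * l := by positivity
    have h1 : R * l ≤ T * l := by gcongr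
    simp only [Set.mem_iUnion, Finset.mem_Icc, Int.ceil_le, Int.le_floor, Set.mem_Ioo,
      div_lt_iff₀ hl, lt_div_iff₀ hl]
    exact ⟨k, ⟨by linarith, by linarith⟩, by linarith, by linarith⟩
  have hcard : ((Finset.Icc ⌈-δ⌉ ⌊T * l + δ⌋).card : ℝ) ≤ T * l + 2 * δ + 1 := by
    have hnonneg : 0 ≤ ⌊T * l + δ⌋ + 1 - ⌈-δ⌉ := by
      have h1 : ⌈-δ⌉ ≤ 0 := Int.ceil_le.2 (by simpa)
      have h2 : 0 ≤ ⌊T * l + δ⌋ := Int.floor_nonneg.2 (by positivity)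
      omega
    rw [Int.card_Icc, ← Int.cast_natCast, Int.toNat_of_nonneg hnonneg]
    push_cast
    linarith [Int.floor_le (T * l + δ), Int.le_ceil (-δ)]
  calc MeasureTheory.volume {R ∈ Set.Icc 0 T | ∃ k : ℤ, |R * l - k| < δ}
      ≤ ∑ k ∈ Finset.Icc ⌈-δ⌉ ⌊T * l + δ⌋,
          MeasureTheory.volume (Set.Ioo ((k - δ) / l) ((k + δ) / l)) :=
        (MeasureTheory.measure_mono hcover).trans (MeasureTheory.measure_biUnion_finset_le _ _)
    _ = ENNReal.ofReal ((Finset.Icc ⌈-δ⌉ ⌊T * l + δ⌋).card * (2 * δ / l)) := by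
        simp only [Real.volume_Ioo, ← sub_div, add_sub_sub_cancel, ← two_mul, Finset.sum_const]
        rw [← ENNReal.ofReal_nsmul, nsmul_eq_mul]
    _ ≤ ENNReal.ofReal (2 * δ * T + (2 * δ + 1) * (2 * δ / l)) := by
        refine ENNReal.ofReal_le_ofReal ?_
        calc ((Finset.Icc ⌈-δ⌉ ⌊T * l + δ⌋).card : ℝ) * (2 * δ / l)
            ≤ (T * l + 2 * δ + 1) * (2 * δ / l) := by gcongr
          _ = 2 * δ * T + (2 * δ + 1) * (2 * δ / l) := by
            field_simp
            ring

-- The inadmissible parameters have upper density at most `2nδ < 1`.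
theorem frequently_mem_admissibleFor {ι : Type*} [Fintype ι] {L : ι → ℝ} (hL : ∀ m, 0 < L m)
    {δ : ℝ} (hδ : 2 * Fintype.card ι * δ < 1) : ∃ᶠ R in atTop, R ∈ admissibleFor L δ := by
  rcases le_or_gt δ 0 with hδ0 | hδ0
  · exact (Eventually.of_forall fun R m k => hδ0.trans (abs_nonneg _)).frequently
  intro hnot
  obtain ⟨R₀, hR₀⟩ := eventually_atTop.1 (hnot.and (eventually_ge_atTop 0))
  set B : ι → ℝ := fun m => (2 * δ + 1) * (2 * δ / L m)
  have hB : ∀ m, 0 ≤ B m := fun m => by have := hL m; positivity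
  have hbound : ∀ T ≥ R₀, T - R₀ ≤ 2 * Fintype.card ι * δ * T + ∑ m, B m := fun T hT => by
    have hT0 : 0 ≤ T := (hR₀ T hT).2
    have hcover : Set.Icc R₀ T ⊆
        ⋃ m, {R ∈ Set.Icc 0 T | ∃ k : ℤ, |R * L m - k| < δ} := fun R hR => by
      have h := (hR₀ R hR.1).1
      simp only [admissibleFor, Set.mem_ofPred_eq, not_forall, not_le] at h
      obtain ⟨m, hm⟩ := h
      exact Set.mem_iUnion.2 ⟨m, ⟨(hR₀ R hR.1).2, hR.2⟩, hm⟩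
    have hvolume := (MeasureTheory.measure_mono hcover).trans
      ((MeasureTheory.measure_iUnion_fintype_le MeasureTheory.volume _).trans
        (Finset.sum_le_sum fun m _ => volume_near_int_le (hL m) hδ0.le hT0))
    rw [Real.volume_Icc, ← ENNReal.ofReal_sum_of_nonneg fun m _ =>
      add_nonneg (by positivity) (hB m)] at hvolume
    have hle := (ENNReal.ofReal_le_ofReal_iff (Finset.sum_nonneg fun m _ =>
      add_nonneg (by positivity) (hB m))).1 hvolume
    rw [Finset.sum_add_distrib, Finset.sum_const, Finset.card_univ, nsmul_eq_mul] at hle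
    linarith
  have hlarge : Tendsto (fun T => (1 - 2 * Fintype.card ι * δ) * T) atTop atTop :=
    tendsto_id.const_mul_atTop (sub_pos.2 hδ)
  obtain ⟨T, hTR₀, hT⟩ := ((eventually_ge_atTop R₀).and
    (hlarge.eventually_gt_atTop (R₀ + ∑ m, B m))).exists
  linarith [hbound T hTR₀]

/-! ### The explicit formula -/

section Explicit

variable {ι : Type*} {L : ι → ℝ} {δ u : ℝ}

theorem tendsto_trigPartialSum_empty {m : ι} (hm : 0 < L m) (u : ℝ) :
    Tendsto (trigPartialSum L u m ∅) atTop (𝓝 (-π * B1star (u / L m))) := by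
  have hfloor : Tendsto (fun R : ℝ => ⌊R * L m⌋₊) atTop atTop :=
    tendsto_nat_floor_atTop.comp (tendsto_id.atTop_mul_const hm)
  refine ((tendsto_sum_sin_div (u / L m)).comp hfloor).congr fun R => ?_
  simp [trigPartialSum]

variable [Fintype ι] [DecidableEq ι]

/-- The sum of the truncated series over all `m` and all nonempty sets of further indices; with
`L = log ∘ a` it is `truncatedSum`. -/
noncomputable def cotangentSum (L : ι → ℝ) (u R : ℝ) : ℝ :=
  ∑ m, ∑ t ∈ (Finset.univ.erase m).powerset.erase ∅, trigPartialSum L u m t R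

theorem sum_trigPartialSum (L : ι → ℝ) (u R : ℝ) :
    ∑ m, ∑ t ∈ (Finset.univ.erase m).powerset, trigPartialSum L u m t R
      = ∑ m, trigPartialSum L u m ∅ R + cotangentSum L u R := by
  rw [cotangentSum, ← Finset.sum_add_distrib]
  exact Finset.sum_congr rfl fun m _ =>
    (Finset.add_sum_erase _ _ (Finset.empty_mem_powerset _)).symm

theorem tendsto_residue_add_cotangentSum (hL : ∀ m, 0 < L m)
    (hi : Pairwise fun m l => Irrational (L m / L l)) (hδ : 0 < δ) (hu : -∑ m, L m < u) :
    Tendsto (fun R => residue (expKernel L u) 0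
        + ((-(1 / 2 ^ (Fintype.card ι - 1)) * ∑ m, B1star (u / L m)
          + 1 / (2 ^ (Fintype.card ι - 1) * π) * cotangentSum L u R
          + 1 / 2 * {q : ι → ℕ | ∑ m, q m * L m = u}.ncard : ℝ) : ℂ))
      (atTop ⊓ 𝓟 (admissibleFor L δ)) (𝓝 ({q : ι → ℕ | ∑ m, q m * L m ≤ u}.ncard : ℂ)) := by
  set c : ℝ := 2 ^ (Fintype.card ι - 1)
  set b := ∑ m, B1star (u / L m)
  set N₀ : ℝ := ({q : ι → ℕ | ∑ m, q m * L m = u}.ncard : ℝ)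
  set N : ℕ := {q : ι → ℕ | ∑ m, q m * L m ≤ u}.ncard
  have hsawtooth : Tendsto (fun R => ∑ m, trigPartialSum L u m ∅ R)
      (atTop ⊓ 𝓟 (admissibleFor L δ)) (𝓝 (-π * b)) := by
    rw [Finset.mul_sum]
    exact (tendsto_finsetSum _ fun m _ => tendsto_trigPartialSum_empty (hL m) u).mono_left
      inf_le_left
  have hcorrection := (Complex.continuous_ofReal.tendsto _).comp
    (((hsawtooth.const_mul (1 / (c * π))).const_sub (-(1 / c) * b)).add_const (1 / 2 * N₀))
  have hvalue : ((N - 1 / 2 * N₀ : ℝ) : ℂ)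
      + ((-(1 / c) * b - 1 / (c * π) * (-π * b) + 1 / 2 * N₀ : ℝ) : ℂ) = N := by
    rw [← Complex.ofReal_add, ← Complex.ofReal_natCast]
    congr 1
    have := Real.pi_ne_zero
    field_simp
    ring
  rw [← hvalue]
  refine ((tendsto_circleIntegral_expKernel hL hδ hu).add hcorrection).congr' ?_
  filter_upwards [mem_inf_of_left (eventually_gt_atTop 0),
    eventually_mem_admissibleFor] with R hR0 hR
  rw [circleIntegral_expKernel hL hi u hδ hR0 hR, sum_trigPartialSum, add_assoc,
    Function.comp_apply, ← Complex.ofReal_add]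
  congr 2
  ring

end Explicit

section Arithmetic

variable {n : ℕ} {a : Fin n → ℕ}

theorem powProd_single (a : Fin n → ℕ) (m : Fin n) (k : ℕ) :
    powProd a (Pi.single m k) = a m ^ k := by
  rw [powProd, Finset.prod_eq_single m (fun l _ hl => by simp [hl]) (by simp), Pi.single_eq_same]

theorem two_le_of_injective (ha : Function.Injective (powProd a)) (m : Fin n) : 2 ≤ a m := by
  by_contra! h
  have hpow : powProd a (Pi.single m 1) = powProd a (Pi.single m 2) := by
    rw [powProd_single, powProd_single]
    interval_cases a m <;> norm_num
  simpa using congrFun (ha hpow) m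

theorem log_pos_of_injective (ha : Function.Injective (powProd a)) (m : Fin n) :
    0 < Real.log (a m) :=
  Real.log_pos (by exact_mod_cast two_le_of_injective ha m)

theorem irrational_log_div_log (ha : Function.Injective (powProd a)) :
    Pairwise fun m l => Irrational (Real.log (a m) / Real.log (a l)) := by
  intro m l hml
  have hm := log_pos_of_injective ha m
  have hl := log_pos_of_injective ha l
  refine (irrational_iff_ne_rational _).2 fun i j hj heq => ?_
  have habs : (j.natAbs : ℝ) * Real.log (a m) = i.natAbs * Real.log (a l) := by
    rw [div_eq_div_iff hl.ne' (Int.cast_ne_zero.2 hj)] at heq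
    have h := congrArg abs heq
    rw [abs_mul, abs_mul, abs_of_pos hm, abs_of_pos hl] at h
    rw [Nat.cast_natAbs, Nat.cast_natAbs, Int.cast_abs, Int.cast_abs, mul_comm, h]
  have hpow : a m ^ j.natAbs = a l ^ i.natAbs := by
    have hpos : ∀ (k : Fin n) (e : ℕ), (0 : ℝ) < (a k : ℝ) ^ e := fun k e =>
      pow_pos (Nat.cast_pos.2 (two_pos.trans_le (two_le_of_injective ha k))) e
    rw [← Real.log_pow, ← Real.log_pow] at habs
    exact_mod_cast Real.log_injOn_pos (hpos m _) (hpos l _) habs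
  rw [← powProd_single, ← powProd_single] at hpow
  have h := congrFun (ha hpow) m
  rw [Pi.single_eq_same, Pi.single_eq_of_ne hml] at h
  exact hj (Int.natAbs_eq_zero.1 h)

theorem kernel_eq_expKernel (ha : ∀ m, a m ≠ 0) {x : ℝ} (hx : 0 < x) :
    kernel a x = expKernel (fun m => Real.log (a m)) (Real.log x) := by
  funext s
  rw [kernel, expKernel, Complex.cpow_def_of_ne_zero (Complex.ofReal_ne_zero.2 hx.ne'),
    Complex.ofReal_log hx.le]
  congr 2
  refine Finset.prod_congr rfl fun m _ => ?_
  rw [Complex.cpow_def_of_ne_zero (Nat.cast_ne_zero.2 (ha m)), Complex.exp_neg, one_div,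
    Complex.ofReal_log (Nat.cast_nonneg _), Complex.ofReal_natCast]

theorem log_powProd (ha : ∀ m, a m ≠ 0) (q : Fin n → ℕ) :
    Real.log (powProd a q) = ∑ m, q m * Real.log (a m) := by
  rw [powProd, Nat.cast_prod, Real.log_prod fun m _ => by simp [ha m]]
  simp only [Nat.cast_pow, Real.log_pow]

theorem powProd_pos (ha : ∀ m, a m ≠ 0) (q : Fin n → ℕ) : (0 : ℝ) < powProd a q :=
  Nat.cast_pos.2 (Finset.prod_pos fun m _ => pow_pos (Nat.pos_of_ne_zero (ha m)) _)

theorem count_eq_ncard (ha : ∀ m, a m ≠ 0) {x : ℝ} (hx : 0 < x) :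
    count a x = {q : Fin n → ℕ | ∑ m, q m * Real.log (a m) ≤ Real.log x}.ncard := by
  simp only [count, ← log_powProd ha, Real.log_le_log_iff (powProd_pos ha _) hx]

theorem chi_eq_ncard (ha : Function.Injective (powProd a)) {x : ℝ} (hx : 0 < x) :
    chi a x = {q : Fin n → ℕ | ∑ m, q m * Real.log (a m) = Real.log x}.ncard := by
  have ha0 : ∀ m, a m ≠ 0 := fun m => (two_pos.trans_le (two_le_of_injective ha m)).ne'
  simp only [← log_powProd ha0, Real.log_injOn_pos.eq_iff (powProd_pos ha0 _) hx]
  by_cases hxS : x ∈ productSet a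
  · obtain ⟨q, hq⟩ := id hxS
    have hsingle : {q' : Fin n → ℕ | (powProd a q' : ℝ) = x} = {q} := by
      ext q'
      simp [← hq, ha.eq_iff]
    rw [chi, Set.indicator_of_mem hxS, hsingle, Set.ncard_singleton, Nat.cast_one, Pi.one_apply]
  · have hempty : {q : Fin n → ℕ | (powProd a q : ℝ) = x} = ∅ :=
      Set.eq_empty_of_forall_notMem fun q hq => hxS ⟨q, hq⟩
    rw [chi, Set.indicator_of_notMem hxS, hempty, Set.ncard_empty, Nat.cast_zero]

theorem truncatedSum_eq_cotangentSum (a : Fin n → ℕ) (x R : ℝ) :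
    truncatedSum a x R = cotangentSum (fun m => Real.log (a m)) (Real.log x) R := by
  refine Finset.sum_congr rfl fun m _ => ?_
  have hcard : (Finset.univ.erase m).card = n - 1 := by
    rw [Finset.card_erase_of_mem (Finset.mem_univ m), Finset.card_univ, Fintype.card_fin]
  refine add_left_cancel (a := partialSeries a x m ∅ R) ?_
  calc partialSeries a x m ∅ R
        + ∑ r ∈ Finset.Icc 1 (n - 1), ∑ t ∈ (Finset.univ.erase m).powersetCard r,
          partialSeries a x m t R
      = ∑ t ∈ (Finset.univ.erase m).powerset, partialSeries a x m t R := by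
        rw [Finset.sum_powerset, hcard, Finset.range_eq_Ico,
          Finset.sum_eq_sum_Ico_succ_bot (Nat.add_one_pos _), Finset.powersetCard_zero,
          Finset.sum_singleton, zero_add, Finset.Ico_add_one_right_eq_Icc]
    _ = partialSeries a x m ∅ R + ∑ t ∈ (Finset.univ.erase m).powerset.erase ∅,
          trigPartialSum (fun m => Real.log (a m)) (Real.log x) m t R :=
        (Finset.add_sum_erase _ _ (Finset.empty_mem_powerset _)).symm

end Arithmetic

end SmoothCount

open SmoothCount in
theorem theorem11_general {ι : Type*} [Fintype ι] [DecidableEq ι] {L : ι → ℝ} (hL : ∀ m, 0 < L m)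
    (hi : Pairwise fun m l => Irrational (L m / L l)) :
    (∀ δ : ℝ, 2 * Fintype.card ι * δ < 1 → ∃ᶠ R in atTop, R ∈ admissibleFor L δ) ∧
    ∀ u : ℝ, -∑ m, L m < u → ∀ δ : ℝ, 0 < δ →
      Tendsto
        (fun R => residue (expKernel L u) 0
          + ((-(1 / 2 ^ (Fintype.card ι - 1)) * ∑ m, B1star (u / L m)
            + 1 / (2 ^ (Fintype.card ι - 1) * Real.pi) * cotangentSum L u R
            + 1 / 2 * {q : ι → ℕ | ∑ m, q m * L m = u}.ncard : ℝ) : ℂ))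
        (atTop ⊓ 𝓟 (admissibleFor L δ)) (𝓝 ({q : ι → ℕ | ∑ m, q m * L m ≤ u}.ncard : ℂ)) :=
  ⟨fun _ => frequently_mem_admissibleFor hL,
    fun _ hu _ hδ => tendsto_residue_add_cotangentSum hL hi hδ hu⟩

theorem theorem11 {n : ℕ} (hn : 1 ≤ n) (a : Fin n → ℕ) (ha : StrictMono a)
    (ha_indep : Function.Injective (SmoothCount.powProd a)) :
    (∀ δ : ℝ, δ < 1 / (2 * n) → ∃ᶠ R in Filter.atTop, R ∈ SmoothCount.admissible a δ) ∧
    ∀ x : ℝ, 1 ≤ x → ∀ δ : ℝ, 0 < δ →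
      Filter.Tendsto
        (fun R : ℝ =>
          SmoothCount.residue (SmoothCount.kernel a x) 0
            + ((-(1 / 2 ^ (n - 1)) * ∑ k, SmoothCount.B1star (Real.log x / Real.log (a k))
              + 1 / (2 ^ (n - 1) * Real.pi) * SmoothCount.truncatedSum a x R
              + 1 / 2 * SmoothCount.chi a x : ℝ) : ℂ))
        (Filter.atTop ⊓ Filter.principal (SmoothCount.admissible a δ))
        (nhds (SmoothCount.count a x : ℂ)) := by
  have hL := SmoothCount.log_pos_of_injective ha_indep
  obtain ⟨hfreq, hlim⟩ := theorem11_general hL (SmoothCount.irrational_log_div_log ha_indep)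
  rw [Fintype.card_fin] at hfreq hlim
  refine ⟨fun δ hδ => hfreq δ ((lt_div_iff₀' (by positivity)).1 hδ), fun x hx δ hδ => ?_⟩
  have ha0 : ∀ m, a m ≠ 0 := fun m =>
    (two_pos.trans_le (SmoothCount.two_le_of_injective ha_indep m)).ne'
  have hx0 : 0 < x := one_pos.trans_le hx
  have : Nonempty (Fin n) := ⟨⟨0, hn⟩⟩
  have hu : -∑ m, Real.log (a m) < Real.log x := (neg_neg_of_pos
    (Finset.sum_pos (fun m _ => hL m) Finset.univ_nonempty)).trans_le (Real.log_nonneg hx)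
  simp only [SmoothCount.kernel_eq_expKernel ha0 hx0, SmoothCount.chi_eq_ncard ha_indep hx0,
    SmoothCount.count_eq_ncard ha0 hx0, SmoothCount.truncatedSum_eq_cotangentSum]
  exact hlim _ hu δ hδ
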